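/- Let $D_1,D_2,D_3\subseteq\mathbb R^2$ be open and let $F_i:D_i\to\mathbb R$ ($i=1,2,3$) be smooth. Consider three points of equal (unit) mass on a line, with positions $x^i$ and momenta $p_i$, put $X_i=x^i-x^{i+1}$ (indices mod $3$), and let $\Omega\subseteq\mathbb R^3$ be the set of configurations with $X_i\neq0$ and $(X_{i+1}/X_i,\,X_{i+2}/X_i)\in D_i$ for all $i$. Assume that $\mathbb R^3\setminus\Omega$ (which is closed) has Lebesgue measure zero. Let $$H=\tfrac12(p_1^2+p_2^2+p_3^2)+\sum_{i=1}^3\frac1{X_i^2}\,F_i\!\left(\frac{X_{i+1}}{X_i},\frac{X_{i+2}}{X_i}\right)$$ on the phase space $\Omega\times\mathbb R^3$. A first integral is a smooth function on $\Omega\times\mathbb R^3$ whose Poisson bracket with $H$ vanishes, and functions are functionally independent if their differentials are linearly independent on a dense subset of $\Omega\times\mathbb R^3$. Then: (1) The system is quasi maximally superintegrable: it is Liouville integrable (it has three functionally independent first integrals in involution, one of which is $H$), and it has $2\cdot3-2=4$ functionally independent first integrals. The latter can be chosen to include $H$ and to be all quadratic, i.e. of the form $\tfrac12\sum_{i,j}K^{ij}(x)p_ip_j+W(x)$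 with $K^{ij}=K^{ji}$ and $W$ smooth on $\Omega$. (2) Let $(r,\psi,z)$ be the cylindrical coordinates about the axis $(1,1,1)$ given by $r\cos\psi=(x^1-x^2)/\sqrt2$, $r\sin\psi=(x^1+x^2-2x^3)/\sqrt6$, $z=(x^1+x^2+x^3)/\sqrt3$. For every $z_0\in\mathbb R$ and $a>0$, $H$ is separable in each of the following orthogonal coordinate systems $(u,v,\psi)$: - circular cylindrical: $r=u$, $z-z_0=v$ ($u>0$); - spherical: $r=u\sin v$, $z-z_0=u\cos v$ ($u>0$, $0<v<\pi$); - parabolic: $r=uv$, $z-z_0=\tfrac12(u^2-v^2)$ ($u,v>0$); - prolate spheroidal: $r=a\sinh u\sin v$, $z-z_0=a\cosh u\cos v$ ($u>0$, $0<v<\pi$); - oblate spheroidal: $r=a\cosh u\sin v$, $z-z_0=a\sinh u\cos v$ ($u>0$, $0<v<\pi$). Here separable in coordinates $(q^1,q^2,q^3)$ means: through every point of phase space over $\Omega$ and the coordinate domain at which the three momenta conjugate to $q^1,q^2,q^3$ are all nonzero, the Hamilton–Jacobi equation $H=c_1$ has a local smooth complete integral of the form $W=\sum_{i=1}^3W_i(q^i;c_1,c_2,c_3)$,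 with $\det\left(\partial^2W/\partial q^i\partial c_j\right)\neq0$ (that is, $\partial W/\partial q^i$ takes the prescribed values at the given point for some value of the constants $c$). -/

import Mathlib

open MeasureTheory
open scoped ContDiff

noncomputable section

namespace ThreeBody

/-- The phase space of a system with `n` degrees of freedom and configuration space `ℝⁿ`:
pairs `(x, p)` of positions and momenta. -/
abbrev Phase (n : ℕ) : Type := (Fin n → ℝ) × (Fin n → ℝ)

/-- The part of phase space that lies over a set `Ω` of configurations. -/
def phaseOver {n : ℕ} (Ω : Set (Fin n → ℝ)) : Set (Phase n) := Ω ×ˢ Set.univ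

/-- `∂f/∂x^i`. -/
def dPos {n : ℕ} (i : Fin n) (f : Phase n → ℝ) (m : Phase n) : ℝ :=
  fderiv ℝ f m (Pi.single i 1, 0)

/-- `∂f/∂p_i`. -/
def dMom {n : ℕ} (i : Fin n) (f : Phase n → ℝ) (m : Phase n) : ℝ :=
  fderiv ℝ f m (0, Pi.single i 1)

/-- The canonical Poisson bracket `{f, g}`. -/
def poisson {n : ℕ} (f g : Phase n → ℝ) (m : Phase n) : ℝ :=
  ∑ i, (dPos i f m * dMom i g m - dMom i f m * dPos i g m)

/-- The domain of definition `Ω` omits only a closed set of Lebesgue measure zero. -/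
def IsGlobalDomain {n : ℕ} (Ω : Set (Fin n → ℝ)) : Prop :=
  IsOpen Ω ∧ volume Ωᶜ = 0

/-- `f` is a smooth first integral of `H` on the whole phase space over `Ω`. -/
def IsFirstIntegral {n : ℕ} (Ω : Set (Fin n → ℝ)) (H f : Phase n → ℝ) : Prop :=
  ContDiffOn ℝ ∞ f (phaseOver Ω) ∧ ∀ m ∈ phaseOver Ω, poisson f H m = 0

/-- `f = ½ K^{ij}(x) p_i p_j + W(x)` with `K` symmetric, and `K`, `W` smooth on `Ω`. -/
def IsQuadratic {n : ℕ} (Ω : Set (Fin n → ℝ)) (f : Phase n → ℝ) : Prop :=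
  ∃ (K : Fin n → Fin n → (Fin n → ℝ) → ℝ) (W : (Fin n → ℝ) → ℝ),
    (∀ i j, K i j = K j i) ∧ (∀ i j, ContDiffOn ℝ ∞ (K i j) Ω) ∧ ContDiffOn ℝ ∞ W Ω ∧
    ∀ x ∈ Ω, ∀ p : Fin n → ℝ,
      f (x, p) = 1 / 2 * (∑ i, ∑ j, K i j x * p i * p j) + W x

/-- Functional independence on the phase space over `Ω`: the differentials are linearly
independent at the points of a dense subset. -/
def FunctionallyIndependent {n k : ℕ} (Ω : Set (Fin n → ℝ)) (f : Fin k → Phase n → ℝ) : Prop :=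
  phaseOver Ω ⊆ closure {m ∈ phaseOver Ω | LinearIndependent ℝ (fun i => fderiv ℝ (f i) m)}

/-- Liouville integrability: `n` functionally independent first integrals in involution,
the Hamiltonian being one of them. -/
def IsLiouvilleIntegrable {n : ℕ} (Ω : Set (Fin n → ℝ)) (H : Phase n → ℝ) : Prop :=
  ∃ f : Fin n → Phase n → ℝ,
    (∃ i, f i = H) ∧ (∀ i, IsFirstIntegral Ω H (f i)) ∧
    (∀ i j, ∀ m ∈ phaseOver Ω, poisson (f i) (f j) m = 0) ∧
    FunctionallyIndependent Ω f

/-- Quasi maximal superintegrability: globally defined, Liouville integrable, and with `2n - 2`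
functionally independent global first integrals. -/
def IsQuasiMaximallySuperintegrable {n : ℕ} (Ω : Set (Fin n → ℝ)) (H : Phase n → ℝ) : Prop :=
  IsGlobalDomain Ω ∧ IsLiouvilleIntegrable Ω H ∧
  ∃ f : Fin (2 * n - 2) → Phase n → ℝ,
    (∀ i, IsFirstIntegral Ω H (f i)) ∧ FunctionallyIndependent Ω f

/-! ### Separation of variables -/

/-- The coordinate vector field `∂Φ/∂q^i`. -/
def coordVec {n : ℕ} (Φ : (Fin n → ℝ) → (Fin n → ℝ)) (q : Fin n → ℝ) (i : Fin n) : Fin n → ℝ :=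
  fderiv ℝ Φ q (Pi.single i 1)

/-- `Φ` is a smooth (local) system of orthogonal curvilinear coordinates on the open set `D` of
coordinate values: the coordinate vectors are nonzero and pairwise orthogonal. -/
def IsOrthogonalCoordinates {n : ℕ} (D : Set (Fin n → ℝ)) (Φ : (Fin n → ℝ) → (Fin n → ℝ)) :
    Prop :=
  IsOpen D ∧ ContDiffOn ℝ ∞ Φ D ∧
  ∀ q ∈ D, (∀ i, coordVec Φ q i ≠ 0) ∧
    ∀ i j, i ≠ j → coordVec Φ q i ⬝ᵥ coordVec Φ q j = 0

/-- `W₁(q¹, c) + ⋯ + W_n(qⁿ, c)` is a complete integral of the Hamilton-Jacobi equation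
`H = c₀`, written in the coordinates `q`, for `q` near `q₀` and `c` near `c₀`. The momentum `p` at
`Φ q` corresponds to the coordinate momenta `π_i = ⟨p, ∂Φ/∂q^i⟩`. -/
def IsSeparatedCompleteIntegral {n : ℕ} [NeZero n] (H : Phase n → ℝ)
    (Φ : (Fin n → ℝ) → (Fin n → ℝ)) (W : Fin n → ℝ → (Fin n → ℝ) → ℝ)
    (q₀ c₀ : Fin n → ℝ) (ε : ℝ) : Prop :=
  (∀ i, ContDiffOn ℝ ∞ (fun z : ℝ × (Fin n → ℝ) => W i z.1 z.2)
    (Metric.ball (q₀ i) ε ×ˢ Metric.ball c₀ ε)) ∧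
  ∀ q ∈ Metric.ball q₀ ε, ∀ c ∈ Metric.ball c₀ ε,
    (∀ p : Fin n → ℝ, (∀ i, p ⬝ᵥ coordVec Φ q i = deriv (fun t => W i t c) (q i)) →
      H (Φ q, p) = c 0) ∧
    (Matrix.of fun i j : Fin n =>
      fderiv ℝ (fun c' => deriv (fun t => W i t c') (q i)) c (Pi.single j 1)).det ≠ 0

/-- Separability of `H`, considered over `Ω`, in the orthogonal coordinates `Φ` with domain `D`:
the Hamilton-Jacobi equation has, through every point of phase space at which no coordinate momentum
vanishes, a local complete integral that is additively separated in these coordinates.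
(Where some `π_i = 0`, for instance at turning points, a complete integral need not exist.) -/
def IsSeparableIn {n : ℕ} [NeZero n] (Ω : Set (Fin n → ℝ)) (H : Phase n → ℝ)
    (D : Set (Fin n → ℝ)) (Φ : (Fin n → ℝ) → (Fin n → ℝ)) : Prop :=
  IsOrthogonalCoordinates D Φ ∧
  ∀ q₀ ∈ D, Φ q₀ ∈ Ω → ∀ π₀ : Fin n → ℝ, (∀ i, π₀ i ≠ 0) →
    ∃ (ε : ℝ) (c₀ : Fin n → ℝ) (W : Fin n → ℝ → (Fin n → ℝ) → ℝ),
      0 < ε ∧ Metric.ball q₀ ε ⊆ D ∩ Φ ⁻¹' Ω ∧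
      IsSeparatedCompleteIntegral H Φ W q₀ c₀ ε ∧
      ∀ i, deriv (fun t => W i t c₀) (q₀ i) = π₀ i

/-! ### Rotational coordinates about the line spanned by `(1, 1, 1)` -/

/-- The point with cylindrical coordinates `(r, ψ, z)` about the axis `(1, 1, 1)`:
`r cos ψ = (x¹ - x²)/√2`, `r sin ψ = (x¹ + x² - 2x³)/√6`, `z = (x¹ + x² + x³)/√3`. -/
def fromCylindrical (r ψ z : ℝ) : Fin 3 → ℝ :=
  ![r * Real.cos ψ / √2 + r * Real.sin ψ / √6 + z / √3,
    -(r * Real.cos ψ) / √2 + r * Real.sin ψ / √6 + z / √3,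
    -(2 * (r * Real.sin ψ)) / √6 + z / √3]

/-- Rotational coordinates `(q⁰, q¹, q²)`: `(q⁰, q¹)` are coordinates `r = R(q⁰, q¹)`,
`z = z₀ + Z(q⁰, q¹)` in the meridian half-plane, with origin moved by `z₀` along the axis, and
`q² = ψ` is the angle of rotation. -/
def rotChart (z₀ : ℝ) (R Z : ℝ → ℝ → ℝ) (q : Fin 3 → ℝ) : Fin 3 → ℝ :=
  fromCylindrical (R (q 0) (q 1)) (q 2) (z₀ + Z (q 0) (q 1))

/-- Coordinate values with `q⁰ > 0`. -/
def domCylindrical : Set (Fin 3 → ℝ) := {q | 0 < q 0}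

/-- Coordinate values with `q⁰ > 0`, `q¹ > 0`. -/
def domParabolic : Set (Fin 3 → ℝ) := {q | 0 < q 0 ∧ 0 < q 1}

/-- Coordinate values with `q⁰ > 0`, `0 < q¹ < π`. -/
def domSpherical : Set (Fin 3 → ℝ) := {q | 0 < q 0 ∧ 0 < q 1 ∧ q 1 < Real.pi}

/-- Circular cylindrical coordinates: `r = u`, `z = v`. -/
def cylindricalChart (z₀ : ℝ) : (Fin 3 → ℝ) → (Fin 3 → ℝ) :=
  rotChart z₀ (fun u _ => u) (fun _ v => v)

/-- Spherical coordinates: `r = u sin v`, `z = u cos v`. -/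
def sphericalChart (z₀ : ℝ) : (Fin 3 → ℝ) → (Fin 3 → ℝ) :=
  rotChart z₀ (fun u v => u * Real.sin v) (fun u v => u * Real.cos v)

/-- Parabolic coordinates: `r = u v`, `z = (u² - v²)/2`. -/
def parabolicChart (z₀ : ℝ) : (Fin 3 → ℝ) → (Fin 3 → ℝ) :=
  rotChart z₀ (fun u v => u * v) (fun u v => (u ^ 2 - v ^ 2) / 2)

/-- Prolate spheroidal coordinates with focal half-distance `a`:
`r = a sinh u sin v`, `z = a cosh u cos v`. -/
def prolateChart (a z₀ : ℝ) : (Fin 3 → ℝ) → (Fin 3 → ℝ) :=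
  rotChart z₀ (fun u v => a * Real.sinh u * Real.sin v) (fun u v => a * Real.cosh u * Real.cos v)

/-- Oblate spheroidal coordinates with focal radius `a`:
`r = a cosh u sin v`, `z = a sinh u cos v`. -/
def oblateChart (a z₀ : ℝ) : (Fin 3 → ℝ) → (Fin 3 → ℝ) :=
  rotChart z₀ (fun u v => a * Real.cosh u * Real.sin v) (fun u v => a * Real.sinh u * Real.cos v)

/-! ### The three-body system -/

/-- `X_i = x^i - x^{i+1}`, indices mod 3. -/
def relDist (i : Fin 3) (x : Fin 3 → ℝ) : ℝ := x i - x (i + 1)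

/-- The pair `(X_{i+1}/X_i, X_{i+2}/X_i)`. -/
def ratios (i : Fin 3) (x : Fin 3 → ℝ) : ℝ × ℝ :=
  (relDist (i + 1) x / relDist i x, relDist (i + 2) x / relDist i x)

/-- `V = ∑_i X_i⁻² F_i(X_{i+1}/X_i, X_{i+2}/X_i)`. -/
def potential (F : Fin 3 → ℝ × ℝ → ℝ) (x : Fin 3 → ℝ) : ℝ :=
  ∑ i, 1 / relDist i x ^ 2 * F i (ratios i x)

/-- `H = ½ (p₁² + p₂² + p₃²) + V`. -/
def hamiltonian (F : Fin 3 → ℝ × ℝ → ℝ) (m : Phase 3) : ℝ :=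
  1 / 2 * (∑ i, m.2 i ^ 2) + potential F m.1

/-- The regular configurations, when `F_i` is defined on `D i`: no two points collide and every
`F_i` is evaluated inside its domain. -/
def regularConfigs (D : Fin 3 → Set (ℝ × ℝ)) : Set (Fin 3 → ℝ) :=
  {x | ∀ i, relDist i x ≠ 0 ∧ ratios i x ∈ D i}

end ThreeBody

end

/-!
Everything follows from two symmetries of the potential `V`: it is invariant under translations
along `(1, 1, 1)` and homogeneous of degree `-2` (`potential_smul_add`).

In infinitesimal form these are `∑ ∂V/∂xⁱ = 0` and Euler's identity `∑ xⁱ ∂V/∂xⁱ = -2 V`. With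
`P = ∑ p_i`, `Z = ∑ xⁱ` and `E = ∑ xⁱ p_i` they give `Ṗ = 0`, `Ż = P` and `Ė = 2 H`, whence `E P - 2 Z H`
is conserved. The same computation relative to the centre of mass gives the first integral
`r² h - ½ e²`, in which `r` is the distance to the axis `(1, 1, 1)`, `h` the relative energy and `e` the
relative virial; all of these commute with `P`, so that `H`, `½ P²` and this integral are in
involution. The four differentials are independent wherever `det (p, 1, x)`, `P` and `h` do not vanish
(`linearIndependent_fderiv_quadraticIntegrals`). For each fixed `x` these are nontrivial polynomial
conditions on `p`, hence they hold on a dense set.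

In cylindrical coordinates about `(1, 1, 1)` the symmetries say that `V = G(ψ) / r²`. In each of the
rotational systems the Hamilton-Jacobi equation then has the form treated by Stäckel
(`isSeparableIn_of_staeckel`): the squares `(W_i')²` are affine functions of the constants `c` with
coefficients that depend on `qⁱ` alone. Values of `c` that realize prescribed nonzero momenta are found
by inverting the Stäckel matrix, and `W_i` is a primitive of a square root, which is smooth because
its radicand is positive near a point where the momenta do not vanish. Joint smoothness of `W_i` in
`qⁱ` and `c` is `contDiffOn_primitive`.
-/

noncomputable section

namespace ThreeBody

open Set Filter Topology

/-! ### Smooth dependence of integrals on parameters -/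

section ParametricIntegral

variable {E : Type} [NormedAddCommGroup E]

/-- A function continuous on a neighbourhood of `{x} × [0, 1]` is bounded on a thinner
neighbourhood of that segment: a tube-lemma argument. -/
lemma exists_bound_near_segment {G : Type} [NormedAddCommGroup G] {O : Set (E × ℝ)}
    (hO : IsOpen O) {f : E × ℝ → G} (hf : ContinuousOn f O) {x : E}
    (hx : ∀ s ∈ Icc (0 : ℝ) 1, (x, s) ∈ O) :
    ∃ C : ℝ, ∀ᶠ y in 𝓝 x, ∀ s ∈ Icc (0 : ℝ) 1, (y, s) ∈ O ∧ ‖f (y, s)‖ ≤ C := by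
  have hsub : ({x} : Set E) ×ˢ Icc (0 : ℝ) 1 ⊆ O := by
    rintro ⟨y, s⟩ ⟨hy, hs⟩
    obtain rfl : y = x := hy
    exact hx s hs
  have hK : IsCompact (({x} : Set E) ×ˢ Icc (0 : ℝ) 1) := isCompact_singleton.prod isCompact_Icc
  obtain ⟨C, hC⟩ := hK.exists_bound_of_continuousOn (hf.mono hsub)
  have hopen : IsOpen (O ∩ (fun z => ‖f z‖) ⁻¹' Iio (C + 1)) :=
    hf.norm.isOpen_inter_preimage hO isOpen_Iio
  obtain ⟨u, v, hu, -, hxu, hv, huv⟩ := generalized_tube_lemma isCompact_singleton isCompact_Icc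
    hopen (fun z hz => ⟨hsub hz, (hC z hz).trans_lt (lt_add_one C)⟩)
  refine ⟨C + 1, ?_⟩
  filter_upwards [hu.mem_nhds (hxu rfl)] with y hy s hs
  have := huv (mk_mem_prod hy (hv hs))
  exact ⟨this.1, le_of_lt this.2⟩

lemma continuousOn_slice {G : Type} [NormedAddCommGroup G] {O : Set (E × ℝ)}
    {f : E × ℝ → G} (hf : ContinuousOn f O) {x : E}
    (hx : ∀ s ∈ Icc (0 : ℝ) 1, (x, s) ∈ O) :
    ContinuousOn (fun s => f (x, s)) (uIcc (0 : ℝ) 1) := by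
  rw [uIcc_of_le zero_le_one]
  exact hf.comp (by fun_prop) hx

variable {G : Type} [NormedAddCommGroup G] [NormedSpace ℝ G]

lemma continuousOn_integral_unit {O : Set (E × ℝ)} (hO : IsOpen O) {U : Set E}
    {f : E × ℝ → G} (hf : ContinuousOn f O)
    (hU : ∀ x ∈ U, ∀ s ∈ Icc (0 : ℝ) 1, (x, s) ∈ O) :
    ContinuousOn (fun x => ∫ s in (0 : ℝ)..1, f (x, s)) U := by
  intro x hx
  apply ContinuousAt.continuousWithinAt
  obtain ⟨C, hC⟩ := exists_bound_near_segment hO hf (hU x hx)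
  have hIoc : ∀ s ∈ uIoc (0 : ℝ) 1, s ∈ Icc (0 : ℝ) 1 := by
    intro s hs
    rw [uIoc_of_le zero_le_one] at hs
    exact ⟨hs.1.le, hs.2⟩
  refine intervalIntegral.continuousAt_of_dominated_interval (bound := fun _ => C) ?_ ?_
    intervalIntegrable_const ?_
  · filter_upwards [hC] with y hy
    exact ((continuousOn_slice hf fun s hs => (hy s hs).1).intervalIntegrable).def'.1
  · filter_upwards [hC] with y hy
    exact ae_of_all _ fun s hs => (hy s (hIoc s hs)).2
  · refine ae_of_all _ fun s hs => ?_
    exact (hf.continuousAt (hO.mem_nhds (hU x hx s (hIoc s hs)))).comp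
      (f := fun y => (y, s)) (by fun_prop)

variable [NormedSpace ℝ E]

lemma hasFDerivAt_integral_unit {O : Set (E × ℝ)} (hO : IsOpen O) {f : E × ℝ → G}
    (hf : ContDiffOn ℝ 1 f O) {x : E} (hx : ∀ s ∈ Icc (0 : ℝ) 1, (x, s) ∈ O) :
    HasFDerivAt (fun x => ∫ s in (0 : ℝ)..1, f (x, s))
      (∫ s in (0 : ℝ)..1, (fderiv ℝ f (x, s)).comp (ContinuousLinearMap.inl ℝ E ℝ)) x := by
  have hd : ContinuousOn (fun z => (fderiv ℝ f z).comp (ContinuousLinearMap.inl ℝ E ℝ)) O :=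
    (hf.continuousOn_fderiv_of_isOpen hO le_rfl).clm_comp continuousOn_const
  obtain ⟨C, hC⟩ := exists_bound_near_segment hO hd hx
  have hIoc : ∀ s ∈ uIoc (0 : ℝ) 1, s ∈ Icc (0 : ℝ) 1 := by
    intro s hs
    rw [uIoc_of_le zero_le_one] at hs
    exact ⟨hs.1.le, hs.2⟩
  refine intervalIntegral.hasFDerivAt_integral_of_dominated_of_fderiv_le (𝕜 := ℝ)
    (F := fun x s => f (x, s))
    (F' := fun x s => (fderiv ℝ f (x, s)).comp (ContinuousLinearMap.inl ℝ E ℝ))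
    (bound := fun _ => C) hC ?_ ?_ ?_ ?_ intervalIntegrable_const ?_
  · filter_upwards [hC] with y hy
    exact ((continuousOn_slice hf.continuousOn fun s hs => (hy s hs).1).intervalIntegrable).def'.1
  · exact (continuousOn_slice hf.continuousOn hx).intervalIntegrable
  · exact ((continuousOn_slice hd hx).intervalIntegrable).def'.1
  · exact ae_of_all _ fun s hs y hy => (hy s (hIoc s hs)).2
  · refine ae_of_all _ fun s hs y hy => ?_
    have h1 : HasFDerivAt f (fderiv ℝ f (y, s)) (y, s) :=
      ((hf.contDiffAt (hO.mem_nhds (hy s (hIoc s hs)).1)).differentiableAt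
        one_ne_zero).hasFDerivAt
    exact h1.comp y (hasFDerivAt_prodMk_left y s)

/-- The integral over `[0, 1]` of a `C^k` function is a `C^k` function of the parameter, by
induction on `k`: the derivative is again such an integral. -/
lemma contDiffOn_integral_unit_nat {O : Set (E × ℝ)} (hO : IsOpen O) {U : Set E}
    (hUo : IsOpen U) (hU : ∀ x ∈ U, ∀ s ∈ Icc (0 : ℝ) 1, (x, s) ∈ O) (k : ℕ) :
    ∀ {G : Type} [NormedAddCommGroup G] [NormedSpace ℝ G] {f : E × ℝ → G},
      ContDiffOn ℝ k f O → ContDiffOn ℝ k (fun x => ∫ s in (0 : ℝ)..1, f (x, s)) U := by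
  induction k with
  | zero =>
    intro G _ _ f hf
    simp only [Nat.cast_zero, contDiffOn_zero] at hf ⊢
    exact continuousOn_integral_unit hO hf hU
  | succ k ih =>
    intro G _ _ f hf
    have hder : ∀ x ∈ U, HasFDerivAt (fun x => ∫ s in (0 : ℝ)..1, f (x, s))
        (∫ s in (0 : ℝ)..1, (fderiv ℝ f (x, s)).comp (ContinuousLinearMap.inl ℝ E ℝ)) x :=
      fun x hx => hasFDerivAt_integral_unit hO
        (hf.of_le (by exact_mod_cast Nat.succ_le_succ (Nat.zero_le k))) (hU x hx)
    have hf' : ContDiffOn ℝ (k + 1 : ℕ∞ω) f O := by exact_mod_cast hf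
    have hd := ((contDiffOn_succ_iff_fderiv_of_isOpen hO).1 hf').2.2
    have : ContDiffOn ℝ (k + 1 : ℕ∞ω) (fun x => ∫ s in (0 : ℝ)..1, f (x, s)) U := by
      rw [contDiffOn_succ_iff_fderiv_of_isOpen hUo]
      refine ⟨fun x hx => (hder x hx).differentiableAt.differentiableWithinAt, by simp, ?_⟩
      refine (ih (f := fun z => (fderiv ℝ f z).comp (ContinuousLinearMap.inl ℝ E ℝ))
        (hd.clm_comp contDiffOn_const)).congr fun x hx => (hder x hx).fderiv
    exact_mod_cast this

lemma contDiffOn_integral_unit {O : Set (E × ℝ)} (hO : IsOpen O) {U : Set E}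
    (hUo : IsOpen U) (hU : ∀ x ∈ U, ∀ s ∈ Icc (0 : ℝ) 1, (x, s) ∈ O) {f : E × ℝ → G}
    (hf : ContDiffOn ℝ ∞ f O) : ContDiffOn ℝ ∞ (fun x => ∫ s in (0 : ℝ)..1, f (x, s)) U :=
  contDiffOn_infty.2 fun k =>
    contDiffOn_integral_unit_nat hO hUo hU k (contDiffOn_infty.1 hf k)

/-- The primitive `t ↦ ∫_{a}^{t} g(s, c) ds` of a smooth function is jointly smooth in `t` and in
the parameter `c`. -/
lemma contDiffOn_primitive {g : ℝ × E → ℝ} {a ε : ℝ} {c₀ : E}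
    (hg : ContDiffOn ℝ ∞ g (Metric.ball a ε ×ˢ Metric.ball c₀ ε)) :
    ContDiffOn ℝ ∞ (fun z : ℝ × E => ∫ s in a..z.1, g (s, z.2))
      (Metric.ball a ε ×ˢ Metric.ball c₀ ε) := by
  set B := Metric.ball a ε ×ˢ Metric.ball c₀ ε
  have hB : IsOpen B := Metric.isOpen_ball.prod Metric.isOpen_ball
  -- Rescaling `[a, t]` to `[0, 1]` moves the dependence on `t` into the integrand.
  let φ : (ℝ × E) × ℝ → ℝ × E := fun y => (a + y.2 * (y.1.1 - a), y.1.2)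
  have hφ : ContDiff ℝ ∞ φ := by fun_prop
  have hmem : ∀ z ∈ B, ∀ s ∈ Icc (0 : ℝ) 1, (z, s) ∈ φ ⁻¹' B := by
    rintro ⟨t, c⟩ ⟨ht, hc⟩ s hs
    refine ⟨?_, hc⟩
    simp only [Metric.mem_ball, Real.dist_eq, φ] at ht ⊢
    rw [add_sub_cancel_left, abs_mul, abs_of_nonneg hs.1]
    exact (mul_le_of_le_one_left (abs_nonneg _) hs.2).trans_lt ht
  have h := contDiffOn_integral_unit (hB.preimage hφ.continuous) hB hmem
    (hg.comp hφ.contDiffOn (mapsTo_preimage φ B))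
  have h1 : ContDiff ℝ ∞ (fun z : ℝ × E => z.1 - a) := by fun_prop
  refine (h1.contDiffOn.mul h).congr fun z _ => ?_
  simp only [Function.comp_apply, φ]
  have := intervalIntegral.smul_integral_comp_add_mul (a := 0) (b := 1)
    (fun s => g (s, z.2)) (z.1 - a) a
  simp only [smul_eq_mul, mul_zero, add_zero, mul_one, add_sub_cancel] at this
  rw [← this]
  simp only [mul_comm]

end ParametricIntegral

/-! ### Stäckel's criterion -/

/-- **Stäckel's criterion.** Suppose that in orthogonal coordinates
`H = ∑_i T_i(q) (π_i² - f_i(qⁱ))`, where the `T_i` form the first row of the inverse of an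
invertible matrix `S_ij(qⁱ)` whose `i`-th row depends on `qⁱ` only. Then `H = c₀` is solved by the
functions `W_i` with `(W_i')² = ∑_j c_j S_ij(qⁱ) + f_i(qⁱ)`. -/
theorem isSeparableIn_of_staeckel {n : ℕ} [NeZero n] {Ω : Set (Fin n → ℝ)} {H : Phase n → ℝ}
    {D : Set (Fin n → ℝ)} {Φ : (Fin n → ℝ) → (Fin n → ℝ)} (hΩ : IsOpen Ω)
    (hΦ : IsOrthogonalCoordinates D Φ) (S : Fin n → Fin n → ℝ → ℝ) (f : Fin n → ℝ → ℝ)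
    (T : Fin n → (Fin n → ℝ) → ℝ)
    (hS : ∀ q ∈ D, Φ q ∈ Ω → ∀ i j, ContDiffAt ℝ ∞ (S i j) (q i))
    (hf : ∀ q ∈ D, Φ q ∈ Ω → ∀ i, ContDiffAt ℝ ∞ (f i) (q i))
    (hdet : ∀ q ∈ D, (Matrix.of fun i j => S i j (q i)).det ≠ 0)
    (hT : ∀ q ∈ D, ∀ j, ∑ i, T i q * S i j (q i) = if j = 0 then 1 else 0)
    (hH : ∀ q ∈ D, Φ q ∈ Ω → ∀ p : Fin n → ℝ,
      H (Φ q, p) = ∑ i, T i q * ((p ⬝ᵥ coordVec Φ q i) ^ 2 - f i (q i))) :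
    IsSeparableIn Ω H D Φ := by
  refine ⟨hΦ, fun q₀ hq₀ hq₀Ω π₀ hπ₀ => ?_⟩
  have hUo : IsOpen (D ∩ Φ ⁻¹' Ω) := hΦ.2.1.continuousOn.isOpen_inter_preimage hΦ.1 hΩ
  obtain ⟨δ, hδ, hδU⟩ := Metric.isOpen_iff.1 hUo q₀ ⟨hq₀, hq₀Ω⟩
  -- Every `t` near `q₀ⁱ` is the `i`-th coordinate of an admissible point.
  have hcoord : ∀ i, ∀ t ∈ Metric.ball (q₀ i) δ, ∃ q ∈ D, Φ q ∈ Ω ∧ q i = t := by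
    intro i t ht
    have hmem : Function.update q₀ i t ∈ Metric.ball q₀ δ := by
      rw [Metric.mem_ball, dist_pi_lt_iff hδ]
      intro k
      by_cases hk : k = i
      · subst hk; simpa using ht
      · simpa [Function.update_of_ne hk] using hδ
    exact ⟨_, (hδU hmem).1, (hδU hmem).2, by simp⟩
  let g : Fin n → ℝ × (Fin n → ℝ) → ℝ := fun i z => ∑ j, z.2 j * S i j z.1 + f i z.1
  have hg : ∀ i, ∀ t ∈ Metric.ball (q₀ i) δ, ∀ c, ContDiffAt ℝ ∞ (g i) (t, c) := by
    intro i t ht c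
    obtain ⟨q, hqD, hqΩ, rfl⟩ := hcoord i t ht
    refine ContDiffAt.add (ContDiffAt.sum fun j _ => ContDiffAt.mul (by fun_prop) ?_) ?_
    · exact (hS q hqD hqΩ i j).comp (g := S i j) (q i, c) contDiffAt_fst
    · exact (hf q hqD hqΩ i).comp (g := f i) (q i, c) contDiffAt_fst
  let M : Matrix (Fin n) (Fin n) ℝ := Matrix.of fun i j => S i j (q₀ i)
  -- The constants for which `∂W/∂qⁱ = π₀ i` at `q₀`.
  let c₀ : Fin n → ℝ := M⁻¹.mulVec fun i => π₀ i ^ 2 - f i (q₀ i)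
  have hc₀ : ∀ i, g i (q₀ i, c₀) = π₀ i ^ 2 := by
    intro i
    have h1 : M.mulVec c₀ = fun i => π₀ i ^ 2 - f i (q₀ i) := by
      simp only [c₀, Matrix.mulVec_mulVec]
      rw [Matrix.mul_nonsing_inv _ (isUnit_iff_ne_zero.2 (hdet q₀ hq₀)), Matrix.one_mulVec]
    have h2 := congrFun h1 i
    simp only [Matrix.mulVec, dotProduct, M, Matrix.of_apply] at h2
    simp only [g, mul_comm (c₀ _), h2]
    ring
  have hpos : ∀ i, ∃ e > 0, ∀ z ∈ Metric.ball (q₀ i, c₀) e, 0 < g i z := by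
    intro i
    refine Metric.eventually_nhds_iff_ball.1 ?_
    refine (hg i _ (Metric.mem_ball_self hδ) c₀).continuousAt.eventually_const_lt ?_
    rw [hc₀]
    exact sq_pos_of_ne_zero (hπ₀ i)
  choose e he hge using hpos
  obtain ⟨ε, hε⟩ : ∃ ε, (0 < ε ∧ ε < δ) ∧ ∀ i, 0 < ε ∧ ε < e i :=
    (Eventually.and (f := 𝓝[>] (0 : ℝ)) (Ioo_mem_nhdsGT hδ)
      (eventually_all.2 fun i => Ioo_mem_nhdsGT (he i))).exists
  obtain ⟨⟨hε0, hεδ⟩, hεe⟩ := hε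
  have hgpos : ∀ i, ∀ t ∈ Metric.ball (q₀ i) ε, ∀ c ∈ Metric.ball c₀ ε, 0 < g i (t, c) := by
    intro i t ht c hc
    refine hge i _ ?_
    rw [← ball_prod_same]
    exact ⟨Metric.ball_subset_ball (hεe i).2.le ht, Metric.ball_subset_ball (hεe i).2.le hc⟩
  have hgs : ∀ i, ∀ t ∈ Metric.ball (q₀ i) ε, ∀ c, ContDiffAt ℝ ∞ (g i) (t, c) :=
    fun i t ht c => hg i t (Metric.ball_subset_ball hεδ.le ht) c
  have hsqrt : ∀ i, ContDiffOn ℝ ∞ (fun z => √(g i z))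
      (Metric.ball (q₀ i) ε ×ˢ Metric.ball c₀ ε) := by
    rintro i ⟨t, c⟩ ⟨ht, hc⟩
    exact ((hgs i t ht c).sqrt (hgpos i t ht c hc).ne').contDiffWithinAt
  let σ : Fin n → ℝ := fun i => if 0 < π₀ i then 1 else -1
  have hσ : ∀ i, σ i ^ 2 = 1 := by
    intro i; simp only [σ]; split_ifs <;> norm_num
  have hσ0 : ∀ i, σ i ≠ 0 := by
    intro i h; have := hσ i; simp [h] at this
  let W : Fin n → ℝ → (Fin n → ℝ) → ℝ := fun i t c => σ i * ∫ s in q₀ i..t, √(g i (s, c))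
  have hW : ∀ i, ∀ t ∈ Metric.ball (q₀ i) ε, ∀ c ∈ Metric.ball c₀ ε,
      deriv (fun t => W i t c) t = σ i * √(g i (t, c)) := by
    intro i t ht c hc
    have hcont : ContinuousOn (fun s => √(g i (s, c))) (Metric.ball (q₀ i) ε) :=
      (hsqrt i).continuousOn.comp (by fun_prop) fun s hs => ⟨hs, hc⟩
    have hsub : uIcc (q₀ i) t ⊆ Metric.ball (q₀ i) ε :=
      (convex_ball _ _).ordConnected.uIcc_subset (Metric.mem_ball_self hε0) ht
    exact ((intervalIntegral.integral_hasDerivAt_right (hcont.mono hsub).intervalIntegrable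
      (hcont.stronglyMeasurableAtFilter Metric.isOpen_ball t ht)
      (hcont.continuousAt (Metric.isOpen_ball.mem_nhds ht))).const_mul (σ i)).deriv
  have hball : ∀ q ∈ Metric.ball q₀ ε, ∀ i, q i ∈ Metric.ball (q₀ i) ε :=
    fun q hq i => (dist_pi_lt_iff hε0).1 hq i
  refine ⟨ε, c₀, W, hε0, (Metric.ball_subset_ball hεδ.le).trans hδU, ⟨?_, ?_⟩, ?_⟩
  · intro i
    exact contDiffOn_const.mul (contDiffOn_primitive (hsqrt i))
  · intro q hq c hc
    have hqU := hδU (Metric.ball_subset_ball hεδ.le hq)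
    refine ⟨fun p hp => ?_, ?_⟩
    · rw [hH q hqU.1 hqU.2]
      have h1 : ∀ i, (p ⬝ᵥ coordVec Φ q i) ^ 2 - f i (q i) = ∑ j, c j * S i j (q i) := by
        intro i
        rw [hp i, hW i _ (hball q hq i) c hc, mul_pow, hσ,
          Real.sq_sqrt (hgpos i _ (hball q hq i) c hc).le]
        simp [g]
      calc ∑ i, T i q * ((p ⬝ᵥ coordVec Φ q i) ^ 2 - f i (q i))
          = ∑ j, c j * ∑ i, T i q * S i j (q i) := by
            simp only [h1, Finset.mul_sum]
            rw [Finset.sum_comm]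
            exact Finset.sum_congr rfl fun j _ => Finset.sum_congr rfl fun i _ => by ring
        _ = c 0 := by simp [hT q hqU.1]
    · have hentry : ∀ i j, fderiv ℝ (fun c' => deriv (fun t => W i t c') (q i)) c
          (Pi.single j 1) = σ i / (2 * √(g i (q i, c))) * S i j (q i) := by
        intro i j
        have hqi := hball q hq i
        have heq : (fun c' => deriv (fun t => W i t c') (q i)) =ᶠ[𝓝 c]
            fun c' => σ i * √(∑ j, c' j * S i j (q i) + f i (q i)) := by
          filter_upwards [Metric.isOpen_ball.mem_nhds hc] with c' hc'
          exact hW i _ hqi c' hc'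
        have hlin : HasFDerivAt (fun c' : Fin n → ℝ => ∑ j, c' j * S i j (q i) + f i (q i))
            (∑ j, S i j (q i) • ContinuousLinearMap.proj (R := ℝ) (φ := fun _ : Fin n => ℝ) j)
            c := by
          refine HasFDerivAt.add_const _ (HasFDerivAt.fun_sum fun j _ => ?_)
          exact (hasFDerivAt_apply j c).mul_const (S i j (q i))
        have hs := (hlin.sqrt (hgpos i _ hqi c hc).ne').const_mul (σ i)
        rw [heq.fderiv_eq, hs.fderiv]
        simp only [smul_apply, sum_apply,
          ContinuousLinearMap.proj_apply, smul_eq_mul, Pi.single_apply, mul_ite, mul_one,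
          mul_zero, Finset.mem_univ, if_true, Finset.sum_ite_eq', g]
        ring
      simp only [hentry]
      rw [Matrix.det_mul_column (fun i => σ i / (2 * √(g i (q i, c))))
        (fun i j => S i j (q i))]
      refine mul_ne_zero (Finset.prod_ne_zero_iff.2 fun i _ => div_ne_zero (hσ0 i) ?_)
        (hdet q hqU.1)
      exact mul_ne_zero two_ne_zero (Real.sqrt_pos.2 (hgpos i _ (hball q hq i) c hc)).ne'
  · intro i
    rw [hW i _ (Metric.mem_ball_self hε0) c₀ (Metric.mem_ball_self hε0), hc₀, Real.sqrt_sq_eq_abs]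
    simp only [σ]
    split_ifs with h
    · rw [abs_of_pos h, one_mul]
    · rw [abs_of_nonpos (not_lt.1 h)]; ring

/-! ### Symmetries of the potential -/

lemma relDist_smul_add (i : Fin 3) (x : Fin 3 → ℝ) (a c : ℝ) :
    relDist i (a • x + fun _ => c) = a * relDist i x := by
  simp [relDist]; ring

lemma ratios_smul_add (i : Fin 3) (x : Fin 3 → ℝ) {a : ℝ} (ha : a ≠ 0) (c : ℝ) :
    ratios i (a • x + fun _ => c) = ratios i x := by
  simp only [ratios, relDist_smul_add]
  rw [mul_div_mul_left _ _ ha, mul_div_mul_left _ _ ha]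

/-- The potential is invariant under translations and homogeneous of degree `-2`. -/
lemma potential_smul_add (F : Fin 3 → ℝ × ℝ → ℝ) (x : Fin 3 → ℝ) {a : ℝ} (ha : a ≠ 0) (c : ℝ) :
    potential F (a • x + fun _ => c) = potential F x / a ^ 2 := by
  simp only [potential, ratios_smul_add _ _ ha, relDist_smul_add, Finset.sum_div]
  refine Finset.sum_congr rfl fun i _ => ?_
  rw [mul_pow, one_div, one_div, mul_inv]
  ring

lemma mem_regularConfigs_smul_add {D : Fin 3 → Set (ℝ × ℝ)} {x : Fin 3 → ℝ} {a : ℝ} (ha : a ≠ 0)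
    (c : ℝ) : (a • x + fun _ => c) ∈ regularConfigs D ↔ x ∈ regularConfigs D := by
  simp [regularConfigs, relDist_smul_add, ratios_smul_add _ _ ha, ha]

lemma contDiff_relDist (i : Fin 3) : ContDiff ℝ ∞ (relDist i) := by
  unfold relDist; fun_prop

lemma contDiffOn_ratios (i : Fin 3) : ContDiffOn ℝ ∞ (ratios i) {x | relDist i x ≠ 0} :=
  ((contDiff_relDist _).contDiffOn.div (contDiff_relDist _).contDiffOn fun _ h => h).prodMk
    ((contDiff_relDist _).contDiffOn.div (contDiff_relDist _).contDiffOn fun _ h => h)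

lemma isOpen_regularConfigs {D : Fin 3 → Set (ℝ × ℝ)} (hD : ∀ i, IsOpen (D i)) :
    IsOpen (regularConfigs D) := by
  have : regularConfigs D = ⋂ i, {x | relDist i x ≠ 0} ∩ ratios i ⁻¹' D i := by
    ext x; simp [regularConfigs]
  rw [this]
  refine isOpen_iInter_of_finite fun i => ?_
  exact (contDiffOn_ratios i).continuousOn.isOpen_inter_preimage
    (isOpen_ne_fun (contDiff_relDist i).continuous continuous_const) (hD i)

lemma contDiffOn_potential {D : Fin 3 → Set (ℝ × ℝ)} {F : Fin 3 → ℝ × ℝ → ℝ}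
    (hF : ∀ i, ContDiffOn ℝ ∞ (F i) (D i)) :
    ContDiffOn ℝ ∞ (potential F) (regularConfigs D) := by
  refine ContDiffOn.sum fun i _ => ContDiffOn.mul ?_ ?_
  · exact contDiffOn_const.div ((contDiff_relDist i).contDiffOn.pow 2)
      fun x hx => pow_ne_zero 2 (hx i).1
  · exact (hF i).comp ((contDiffOn_ratios i).mono fun x hx => (hx i).1) fun x hx => (hx i).2

section Derivatives

variable {D : Fin 3 → Set (ℝ × ℝ)} {F : Fin 3 → ℝ × ℝ → ℝ}

lemma contDiffAt_potential (hD : ∀ i, IsOpen (D i)) (hF : ∀ i, ContDiffOn ℝ ∞ (F i) (D i))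
    {x : Fin 3 → ℝ} (hx : x ∈ regularConfigs D) : ContDiffAt ℝ ∞ (potential F) x :=
  (contDiffOn_potential hF).contDiffAt ((isOpen_regularConfigs hD).mem_nhds hx)

lemma differentiableAt_potential (hD : ∀ i, IsOpen (D i)) (hF : ∀ i, ContDiffOn ℝ ∞ (F i) (D i))
    {x : Fin 3 → ℝ} (hx : x ∈ regularConfigs D) : DifferentiableAt ℝ (potential F) x :=
  (contDiffAt_potential hD hF hx).differentiableAt (by simp)

/-- Euler's identity for the potential, which is homogeneous of degree `-2`. -/
lemma fderiv_potential_self (hD : ∀ i, IsOpen (D i)) (hF : ∀ i, ContDiffOn ℝ ∞ (F i) (D i))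
    {x : Fin 3 → ℝ} (hx : x ∈ regularConfigs D) :
    fderiv ℝ (potential F) x x = -2 * potential F x := by
  have h1 : HasDerivAt (fun t : ℝ => t • x) x 1 := by
    simpa using (hasDerivAt_id (1 : ℝ)).smul_const x
  have h2 : HasFDerivAt (potential F) (fderiv ℝ (potential F) x) ((1 : ℝ) • x) := by
    rw [one_smul]; exact (differentiableAt_potential hD hF hx).hasFDerivAt
  have h3 := h2.comp_hasDerivAt (1 : ℝ) h1
  have h4 : HasDerivAt (fun t : ℝ => potential F x / t ^ 2) (-2 * potential F x) 1 := by
    exact ((hasDerivAt_const (1 : ℝ) (potential F x)).fun_div (hasDerivAt_pow 2 (1 : ℝ))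
      (by norm_num)).congr_deriv (by norm_num; ring)
  refine h3.unique (h4.congr_of_eventuallyEq ?_)
  filter_upwards [isOpen_ne.mem_nhds (one_ne_zero : (1 : ℝ) ≠ 0)] with t ht
  have h := potential_smul_add F x ht 0
  rwa [show (fun _ : Fin 3 => (0 : ℝ)) = 0 from rfl, add_zero] at h

/-- Infinitesimal translation invariance of the potential. -/
lemma fderiv_potential_one (hD : ∀ i, IsOpen (D i)) (hF : ∀ i, ContDiffOn ℝ ∞ (F i) (D i))
    {x : Fin 3 → ℝ} (hx : x ∈ regularConfigs D) :
    fderiv ℝ (potential F) x 1 = 0 := by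
  have h1 : HasDerivAt (fun t : ℝ => x + t • (1 : Fin 3 → ℝ)) 1 0 := by
    simpa using ((hasDerivAt_id (0 : ℝ)).smul_const (1 : Fin 3 → ℝ)).const_add x
  have h2 : HasFDerivAt (potential F) (fderiv ℝ (potential F) x)
      (x + (0 : ℝ) • (1 : Fin 3 → ℝ)) := by
    rw [zero_smul, add_zero]; exact (differentiableAt_potential hD hF hx).hasFDerivAt
  have h3 := h2.comp_hasDerivAt (0 : ℝ) h1
  refine h3.unique ((hasDerivAt_const (0 : ℝ) (potential F x)).congr_of_eventuallyEq ?_)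
  refine Eventually.of_forall fun t => ?_
  have h := potential_smul_add F x one_ne_zero t
  simp only [one_smul, one_pow, div_one] at h
  rw [← h]
  simp only [Function.comp_apply]
  congr 1
  ext i
  simp

end Derivatives

/-! ### The quadratic first integrals -/

/-- The total momentum `P = p₁ + p₂ + p₃`. -/
def totalMomentum (m : Phase 3) : ℝ := ∑ i, m.2 i

/-- The sum of the positions `Z = x¹ + x² + x³`, three times the centre of mass. -/
def positionSum (m : Phase 3) : ℝ := ∑ i, m.1 i

/-- The generator of dilations, `E = ⟨x, p⟩`. -/
def virial (m : Phase 3) : ℝ := ∑ i, m.1 i * m.2 i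

/-- `3 r² = 3 |x|² - Z²`, where `r` is the distance to the axis `(1, 1, 1)`. -/
def axisDistSq (m : Phase 3) : ℝ := 3 * (∑ i, m.1 i ^ 2) - positionSum m ^ 2

/-- The energy relative to the centre of mass. -/
def relEnergy (F : Fin 3 → ℝ × ℝ → ℝ) (m : Phase 3) : ℝ :=
  hamiltonian F m - totalMomentum m ^ 2 / 6

/-- The generator of dilations relative to the centre of mass. -/
def relVirial (m : Phase 3) : ℝ := virial m - positionSum m * totalMomentum m / 3

/-- Three times `½ p_ψ² + r² V`, where `p_ψ` is the angular momentum about the axis `(1, 1, 1)`,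
written as `3 r²` times the relative energy minus the part of it that is due to the radial
motion. -/
def angularIntegral (F : Fin 3 → ℝ × ℝ → ℝ) (m : Phase 3) : ℝ :=
  axisDistSq m * relEnergy F m - 3 / 2 * relVirial m ^ 2

/-- The first integral `E P - 2 Z H`; its conservation combines `Ė = 2 H`, the virial identity of
a potential of degree `-2`, with `Ż = P`. -/
def mixedIntegral (F : Fin 3 → ℝ × ℝ → ℝ) (m : Phase 3) : ℝ :=
  virial m * totalMomentum m - 2 * positionSum m * hamiltonian F m

/-- Four quadratic first integrals; the first three are in involution. -/
def quadraticIntegrals (F : Fin 3 → ℝ × ℝ → ℝ) : Fin 4 → Phase 3 → ℝ :=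
  ![hamiltonian F, fun m => 1 / 2 * totalMomentum m ^ 2, angularIntegral F, mixedIntegral F]

lemma isQuadratic_quadraticIntegrals {D : Fin 3 → Set (ℝ × ℝ)} {F : Fin 3 → ℝ × ℝ → ℝ}
    (hF : ∀ i, ContDiffOn ℝ ∞ (F i) (D i)) (k : Fin 4) :
    IsQuadratic (regularConfigs D) (quadraticIntegrals F k) := by
  have hV := contDiffOn_potential hF
  fin_cases k
  · refine ⟨fun i j _ => if i = j then 1 else 0, potential F, ?_, ?_, hV, ?_⟩
    · intro i j; simp only [eq_comm]
    · intro i j; exact contDiffOn_const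
    · intro x _ p
      simp only [quadraticIntegrals, hamiltonian, Fin.sum_univ_three, Fin.isValue,
        Fin.reduceEq, if_true, if_false, Fin.zero_eta, Matrix.cons_val_zero]
      ring
  · refine ⟨fun i j _ => 1, fun _ => 0, ?_, ?_, contDiffOn_const, ?_⟩
    · intro i j; rfl
    · intro i j; exact contDiffOn_const
    · intro x _ p
      simp only [quadraticIntegrals, totalMomentum, Fin.sum_univ_three, Fin.isValue,
        Fin.mk_one, Matrix.cons_val_one, Matrix.cons_val_zero]
      ring
  · refine ⟨fun i j x => (3 * (∑ i, x i ^ 2) - (∑ i, x i) ^ 2) * ((if i = j then 1 else 0) - 1 / 3)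
      - 3 * (x i - (∑ i, x i) / 3) * (x j - (∑ i, x i) / 3),
      fun x => (3 * (∑ i, x i ^ 2) - (∑ i, x i) ^ 2) * potential F x, ?_, ?_, ?_, ?_⟩
    · intro i j
      funext x
      simp only [eq_comm (a := i) (b := j)]
      ring
    · intro i j
      exact ContDiff.contDiffOn (by fun_prop)
    · exact ContDiffOn.mul (ContDiff.contDiffOn (by fun_prop)) hV
    · intro x _ p
      simp only [quadraticIntegrals, angularIntegral, axisDistSq, relEnergy, relVirial,
        hamiltonian, totalMomentum, positionSum, virial, Fin.sum_univ_three, Fin.isValue,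
        Fin.reduceEq, if_true, if_false, Fin.reduceFinMk, Matrix.cons_val]
      ring
  · refine ⟨fun i j x => x i + x j - 2 * (∑ i, x i) * (if i = j then 1 else 0),
      fun x => -2 * (∑ i, x i) * potential F x, ?_, ?_, ?_, ?_⟩
    · intro i j
      funext x
      simp only [eq_comm (a := i) (b := j)]
      ring
    · intro i j
      exact ContDiff.contDiffOn (by fun_prop)
    · exact ContDiffOn.mul (ContDiff.contDiffOn (by fun_prop)) hV
    · intro x _ p
      simp only [quadraticIntegrals, mixedIntegral,
        hamiltonian, totalMomentum, positionSum, virial, Fin.sum_univ_three, Fin.isValue,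
        Fin.reduceEq, if_true, if_false, Fin.reduceFinMk, Matrix.cons_val]
      ring

lemma contDiffOn_quadraticIntegrals {D : Fin 3 → Set (ℝ × ℝ)} {F : Fin 3 → ℝ × ℝ → ℝ}
    (hF : ∀ i, ContDiffOn ℝ ∞ (F i) (D i)) (k : Fin 4) :
    ContDiffOn ℝ ∞ (quadraticIntegrals F k) (phaseOver (regularConfigs D)) := by
  obtain ⟨K, W, -, hK, hW, h⟩ := isQuadratic_quadraticIntegrals hF k
  have hfst : MapsTo Prod.fst (phaseOver (regularConfigs D)) (regularConfigs D) := fun m hm => hm.1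
  refine ContDiffOn.congr (f := fun m : Phase 3 =>
    1 / 2 * (∑ i, ∑ j, K i j m.1 * m.2 i * m.2 j) + W m.1) ?_ fun m hm => h m.1 hm.1 m.2
  refine ContDiffOn.add (contDiffOn_const.mul (ContDiffOn.sum fun i _ => ContDiffOn.sum fun j _ =>
    ContDiffOn.mul (ContDiffOn.mul ?_ ?_) ?_)) (hW.comp contDiffOn_fst hfst)
  · exact (hK i j).comp contDiffOn_fst hfst
  · exact ContDiff.contDiffOn (by fun_prop)
  · exact ContDiff.contDiffOn (by fun_prop)

section Differentials

lemma hasFDerivAt_position (i : Fin 3) (m : Phase 3) :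
    HasFDerivAt (fun y : Phase 3 => y.1 i) ((ContinuousLinearMap.proj (R := ℝ)
      (φ := fun _ : Fin 3 => ℝ) i).comp (ContinuousLinearMap.fst ℝ _ _)) m :=
  HasFDerivAt.comp (g := fun x : Fin 3 → ℝ => x i) m (hasFDerivAt_apply i m.1)
    (hasFDerivAt_fst (𝕜 := ℝ) (E := Fin 3 → ℝ) (F := Fin 3 → ℝ))

lemma hasFDerivAt_momentum (i : Fin 3) (m : Phase 3) :
    HasFDerivAt (fun y : Phase 3 => y.2 i) ((ContinuousLinearMap.proj (R := ℝ)
      (φ := fun _ : Fin 3 => ℝ) i).comp (ContinuousLinearMap.snd ℝ _ _)) m :=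
  HasFDerivAt.comp (g := fun x : Fin 3 → ℝ => x i) m (hasFDerivAt_apply i m.2)
    (hasFDerivAt_snd (𝕜 := ℝ) (E := Fin 3 → ℝ) (F := Fin 3 → ℝ))

variable (m : Phase 3)

lemma hasFDerivAt_totalMomentum : ∃ L : Phase 3 →L[ℝ] ℝ,
    HasFDerivAt totalMomentum L m ∧ ∀ v, L v = ∑ i, v.2 i :=
  ⟨_, HasFDerivAt.fun_sum fun i _ => hasFDerivAt_momentum i m, fun v => by simp⟩

lemma hasFDerivAt_positionSum : ∃ L : Phase 3 →L[ℝ] ℝ,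
    HasFDerivAt positionSum L m ∧ ∀ v, L v = ∑ i, v.1 i :=
  ⟨_, HasFDerivAt.fun_sum fun i _ => hasFDerivAt_position i m, fun v => by simp⟩

lemma hasFDerivAt_virial : ∃ L : Phase 3 →L[ℝ] ℝ,
    HasFDerivAt virial L m ∧ ∀ v, L v = ∑ i, (m.1 i * v.2 i + m.2 i * v.1 i) :=
  ⟨_, HasFDerivAt.fun_sum fun i _ => (hasFDerivAt_position i m).fun_mul (hasFDerivAt_momentum i m),
    fun v => by simp⟩

lemma hasFDerivAt_axisDistSq : ∃ L : Phase 3 →L[ℝ] ℝ, HasFDerivAt axisDistSq L m ∧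
    ∀ v, L v = 6 * ∑ i, m.1 i * v.1 i - 2 * positionSum m * ∑ i, v.1 i := by
  obtain ⟨L, hL, hv⟩ := hasFDerivAt_positionSum m
  refine ⟨_, ((HasFDerivAt.fun_sum fun i _ => (hasFDerivAt_position i m).pow 2).const_mul 3).sub
    (hL.pow 2), fun v => ?_⟩
  simp [hv, Fin.sum_univ_three]
  ring

variable {F : Fin 3 → ℝ × ℝ → ℝ} {m}

lemma hasFDerivAt_hamiltonian (hV : DifferentiableAt ℝ (potential F) m.1) :
    ∃ L : Phase 3 →L[ℝ] ℝ, HasFDerivAt (hamiltonian F) L m ∧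
      ∀ v, L v = ∑ i, m.2 i * v.2 i + fderiv ℝ (potential F) m.1 v.1 := by
  refine ⟨_, ((HasFDerivAt.fun_sum fun i _ => (hasFDerivAt_momentum i m).pow 2).const_mul
    (1 / 2)).add (hV.hasFDerivAt.comp m hasFDerivAt_fst), fun v => ?_⟩
  simp [Fin.sum_univ_three]
  ring

lemma fderiv_half_totalMomentum_sq (v : Phase 3) :
    fderiv ℝ (fun m => 1 / 2 * totalMomentum m ^ 2) m v = totalMomentum m * ∑ i, v.2 i := by
  obtain ⟨L, hL, hv⟩ := hasFDerivAt_totalMomentum m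
  rw [((hL.pow 2).const_mul (1 / 2)).fderiv]
  simp [hv]
  ring

lemma fderiv_hamiltonian (hV : DifferentiableAt ℝ (potential F) m.1) (v : Phase 3) :
    fderiv ℝ (hamiltonian F) m v = ∑ i, m.2 i * v.2 i + fderiv ℝ (potential F) m.1 v.1 := by
  obtain ⟨L, hL, hv⟩ := hasFDerivAt_hamiltonian hV
  rw [hL.fderiv, hv]

lemma fderiv_angularIntegral (hV : DifferentiableAt ℝ (potential F) m.1) (v : Phase 3) :
    fderiv ℝ (angularIntegral F) m v =
      relEnergy F m * (6 * ∑ i, m.1 i * v.1 i - 2 * positionSum m * ∑ i, v.1 i) +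
      axisDistSq m * (∑ i, m.2 i * v.2 i + fderiv ℝ (potential F) m.1 v.1 -
        totalMomentum m * (∑ i, v.2 i) / 3) -
      3 * relVirial m * (∑ i, (m.1 i * v.2 i + m.2 i * v.1 i) -
        (positionSum m * (∑ i, v.2 i) + totalMomentum m * ∑ i, v.1 i) / 3) := by
  obtain ⟨LH, hLH, hH⟩ := hasFDerivAt_hamiltonian hV
  obtain ⟨LP, hLP, hP⟩ := hasFDerivAt_totalMomentum m
  obtain ⟨LZ, hLZ, hZ⟩ := hasFDerivAt_positionSum m
  obtain ⟨LE, hLE, hE⟩ := hasFDerivAt_virial m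
  obtain ⟨LR, hLR, hR⟩ := hasFDerivAt_axisDistSq m
  have h : HasFDerivAt (relEnergy F) _ m := hLH.fun_sub ((hLP.pow 2).mul_const (6⁻¹ : ℝ))
  have e : HasFDerivAt relVirial _ m := hLE.fun_sub ((hLZ.fun_mul hLP).mul_const (3⁻¹ : ℝ))
  have J : HasFDerivAt (angularIntegral F) _ m :=
    (hLR.fun_mul h).fun_sub ((e.pow 2).const_mul (3 / 2))
  rw [J.fderiv]
  simp [hH, hP, hZ, hE, hR]
  ring

lemma fderiv_mixedIntegral (hV : DifferentiableAt ℝ (potential F) m.1) (v : Phase 3) :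
    fderiv ℝ (mixedIntegral F) m v =
      virial m * (∑ i, v.2 i) + totalMomentum m * (∑ i, (m.1 i * v.2 i + m.2 i * v.1 i)) -
      2 * (positionSum m * (∑ i, m.2 i * v.2 i + fderiv ℝ (potential F) m.1 v.1) +
        hamiltonian F m * ∑ i, v.1 i) := by
  obtain ⟨LH, hLH, hH⟩ := hasFDerivAt_hamiltonian hV
  obtain ⟨LP, hLP, hP⟩ := hasFDerivAt_totalMomentum m
  obtain ⟨LZ, hLZ, hZ⟩ := hasFDerivAt_positionSum m
  obtain ⟨LE, hLE, hE⟩ := hasFDerivAt_virial m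
  have N : HasFDerivAt (mixedIntegral F) _ m :=
    (hLE.fun_mul hLP).fun_sub ((hLZ.const_mul 2).fun_mul hLH)
  rw [N.fderiv]
  simp [hH, hP, hZ, hE]
  ring

end Differentials

/-! ### Poisson brackets -/

lemma poisson_swap {n : ℕ} (f g : Phase n → ℝ) (m : Phase n) : poisson f g m = -poisson g f m := by
  simp only [poisson, ← Finset.sum_neg_distrib]
  exact Finset.sum_congr rfl fun i _ => by ring

lemma poisson_self {n : ℕ} (f : Phase n → ℝ) (m : Phase n) : poisson f f m = 0 := by
  simp [poisson, mul_comm]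

section Brackets

variable {D : Fin 3 → Set (ℝ × ℝ)} {F : Fin 3 → ℝ × ℝ → ℝ} {m : Phase 3}

lemma sum_fderiv_potential_mul (x : Fin 3 → ℝ) (y : Fin 3 → ℝ) :
    fderiv ℝ (potential F) x y = ∑ i, y i * fderiv ℝ (potential F) x (Pi.single i 1) := by
  conv_lhs => rw [pi_eq_sum_univ' y, map_sum]
  refine Finset.sum_congr rfl fun i _ => ?_
  rw [map_smul, smul_eq_mul]

lemma translation_identity (hD : ∀ i, IsOpen (D i)) (hF : ∀ i, ContDiffOn ℝ ∞ (F i) (D i))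
    {x : Fin 3 → ℝ} (hx : x ∈ regularConfigs D) :
    ∑ i, fderiv ℝ (potential F) x (Pi.single i 1) = 0 := by
  simpa [sum_fderiv_potential_mul x 1] using fderiv_potential_one hD hF hx

lemma euler_identity (hD : ∀ i, IsOpen (D i)) (hF : ∀ i, ContDiffOn ℝ ∞ (F i) (D i))
    {x : Fin 3 → ℝ} (hx : x ∈ regularConfigs D) :
    ∑ i, x i * fderiv ℝ (potential F) x (Pi.single i 1) = -2 * potential F x := by
  rw [← fderiv_potential_self hD hF hx, sum_fderiv_potential_mul x x]

lemma poisson_totalMomentum_hamiltonian (hD : ∀ i, IsOpen (D i))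
    (hF : ∀ i, ContDiffOn ℝ ∞ (F i) (D i)) (hm : m.1 ∈ regularConfigs D) :
    poisson (fun m => 1 / 2 * totalMomentum m ^ 2) (hamiltonian F) m = 0 := by
  have ht := translation_identity hD hF hm
  simp only [poisson, dPos, dMom, fderiv_half_totalMomentum_sq,
    fderiv_hamiltonian (differentiableAt_potential hD hF hm)]
  simp only [Fin.sum_univ_three] at ht ⊢
  simp [map_zero]
  linear_combination (-totalMomentum m) * ht

lemma poisson_angularIntegral_hamiltonian (hD : ∀ i, IsOpen (D i))
    (hF : ∀ i, ContDiffOn ℝ ∞ (F i) (D i)) (hm : m.1 ∈ regularConfigs D) :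
    poisson (angularIntegral F) (hamiltonian F) m = 0 := by
  have ht := translation_identity hD hF hm
  have he := euler_identity hD hF hm
  have hV := differentiableAt_potential hD hF hm
  simp only [poisson, dPos, dMom, fderiv_angularIntegral hV, fderiv_hamiltonian hV]
  simp only [Fin.sum_univ_three] at ht he ⊢
  simp [map_zero]
  linear_combination (norm := skip)
    (axisDistSq m * totalMomentum m / 3 - relVirial m * positionSum m) * ht +
    3 * relVirial m * he
  simp only [relEnergy, relVirial, axisDistSq, virial, positionSum, totalMomentum, hamiltonian,
    Fin.sum_univ_three]
  ring

lemma poisson_angularIntegral_totalMomentum (hD : ∀ i, IsOpen (D i))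
    (hF : ∀ i, ContDiffOn ℝ ∞ (F i) (D i)) (hm : m.1 ∈ regularConfigs D) :
    poisson (angularIntegral F) (fun m => 1 / 2 * totalMomentum m ^ 2) m = 0 := by
  have ht := translation_identity hD hF hm
  have hV := differentiableAt_potential hD hF hm
  simp only [poisson, dPos, dMom, fderiv_angularIntegral hV, fderiv_half_totalMomentum_sq]
  simp only [Fin.sum_univ_three] at ht ⊢
  simp [map_zero]
  linear_combination (norm := skip) axisDistSq m * totalMomentum m * ht
  simp only [relVirial, virial, positionSum, totalMomentum, Fin.sum_univ_three]
  ring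

lemma poisson_mixedIntegral_hamiltonian (hD : ∀ i, IsOpen (D i))
    (hF : ∀ i, ContDiffOn ℝ ∞ (F i) (D i)) (hm : m.1 ∈ regularConfigs D) :
    poisson (mixedIntegral F) (hamiltonian F) m = 0 := by
  have ht := translation_identity hD hF hm
  have he := euler_identity hD hF hm
  have hV := differentiableAt_potential hD hF hm
  simp only [poisson, dPos, dMom, fderiv_mixedIntegral hV, fderiv_hamiltonian hV]
  simp only [Fin.sum_univ_three] at ht he ⊢
  simp [map_zero]
  linear_combination (norm := skip) (-virial m) * ht - totalMomentum m * he
  simp only [virial, positionSum, totalMomentum, hamiltonian, Fin.sum_univ_three]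
  ring

end Brackets

/-! ### Functional independence -/

lemma isFirstIntegral_quadraticIntegrals {D : Fin 3 → Set (ℝ × ℝ)} {F : Fin 3 → ℝ × ℝ → ℝ}
    (hD : ∀ i, IsOpen (D i)) (hF : ∀ i, ContDiffOn ℝ ∞ (F i) (D i)) (k : Fin 4) :
    IsFirstIntegral (regularConfigs D) (hamiltonian F) (quadraticIntegrals F k) := by
  refine ⟨contDiffOn_quadraticIntegrals hF k, fun m hm => ?_⟩
  fin_cases k
  · exact poisson_self _ m
  · exact poisson_totalMomentum_hamiltonian hD hF hm.1
  · exact poisson_angularIntegral_hamiltonian hD hF hm.1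
  · exact poisson_mixedIntegral_hamiltonian hD hF hm.1

/-- The determinant `det (p, 1, x)`. -/
def momentumDet (x p : Fin 3 → ℝ) : ℝ :=
  p 0 * (x 2 - x 1) + p 1 * (x 0 - x 2) + p 2 * (x 1 - x 0)

/-- If `p`, `1`, `x` are linearly independent, the momentum components of a linear relation between
the four differentials express that a combination of `p`, `1`, `x` vanishes. This determines its
three coefficients, and the position components determine the rest. -/
lemma linearIndependent_fderiv_quadraticIntegrals {F : Fin 3 → ℝ × ℝ → ℝ} {m : Phase 3}
    (hV : DifferentiableAt ℝ (potential F) m.1) (hx : m.1 0 - m.1 1 ≠ 0)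
    (hdet : momentumDet m.1 m.2 ≠ 0) (hP : totalMomentum m ≠ 0) (hh : relEnergy F m ≠ 0) :
    LinearIndependent ℝ (fun i => fderiv ℝ (quadraticIntegrals F i) m) := by
  rw [Fintype.linearIndependent_iff]
  intro c hc
  have key : ∀ v : Phase 3, c 0 * fderiv ℝ (hamiltonian F) m v +
      c 1 * fderiv ℝ (fun m => 1 / 2 * totalMomentum m ^ 2) m v +
      c 2 * fderiv ℝ (angularIntegral F) m v + c 3 * fderiv ℝ (mixedIntegral F) m v = 0 := by
    intro v
    have := congrArg (fun L : Phase 3 →L[ℝ] ℝ => L v) hc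
    simpa [Fin.sum_univ_four, quadraticIntegrals] using this
  simp only [fderiv_hamiltonian hV, fderiv_half_totalMomentum_sq, fderiv_angularIntegral hV,
    fderiv_mixedIntegral hV] at key
  set P := totalMomentum m
  set Z := positionSum m
  set E := virial m
  set e := relVirial m
  set ρ := axisDistSq m
  set h := relEnergy F m
  set H := hamiltonian F m
  -- Coefficients of `p`, `1`, `x` in the momentum components.
  obtain ⟨α, hα⟩ : ∃ α, α = c 0 + c 2 * ρ - 2 * Z * c 3 := ⟨_, rfl⟩
  obtain ⟨β, hβ⟩ : ∃ β, β = c 1 * P - c 2 * ρ * P / 3 + c 2 * e * Z + c 3 * E := ⟨_, rfl⟩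
  obtain ⟨κ, hκ⟩ : ∃ κ, κ = c 3 * P - 3 * e * c 2 := ⟨_, rfl⟩
  have hmom : ∀ i, α * m.2 i + β + κ * m.1 i = 0 := by
    intro i
    have := key (0, Pi.single i 1)
    simp [Pi.single_apply] at this
    rw [hα, hβ, hκ]
    linear_combination this
  have h0 := hmom 0
  have h1 := hmom 1
  have h2 := hmom 2
  have hα0 : α = 0 := by
    refine (mul_eq_zero.1 ?_).resolve_right hdet
    simp only [momentumDet]
    linear_combination (m.1 2 - m.1 1) * h0 + (m.1 0 - m.1 2) * h1 + (m.1 1 - m.1 0) * h2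
  have hκ0 : κ = 0 := by
    refine (mul_eq_zero.1 ?_).resolve_right hx
    rw [hα0] at h0 h1
    linear_combination h0 - h1
  have hβ0 : β = 0 := by
    rw [hα0, hκ0] at h0
    linear_combination h0
  have hpos : ∀ i, 6 * c 2 * h * m.1 i + (-2 * Z * h * c 2 + e * P * c 2 - 2 * H * c 3) = 0 := by
    intro i
    have := key (Pi.single i 1, 0)
    simp [Pi.single_apply] at this
    rw [hα] at hα0
    rw [hκ] at hκ0
    linear_combination this - fderiv ℝ (potential F) m.1 (Pi.single i 1) * hα0 - m.2 i * hκ0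
  have hc2 : c 2 = 0 := by
    have : c 2 * (6 * (h * (m.1 0 - m.1 1))) = 0 := by
      linear_combination hpos 0 - hpos 1
    exact (mul_eq_zero.1 this).resolve_right
      (mul_ne_zero (by norm_num) (mul_ne_zero hh hx))
  have hc3 : c 3 = 0 := by
    refine (mul_eq_zero.1 ?_).resolve_right hP
    rw [hκ0, hc2] at hκ
    linear_combination -hκ
  have hc1 : c 1 = 0 := by
    refine (mul_eq_zero.1 ?_).resolve_right hP
    rw [hβ0, hc2, hc3] at hβ
    linear_combination -hβ
  have hc0 : c 0 = 0 := by
    rw [hα0, hc2, hc3] at hα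
    linear_combination -hα
  intro i
  fin_cases i <;> assumption

open Polynomial in
lemma eventually_quadratic_ne_zero {a b c : ℝ} (h : a ≠ 0 ∨ b ≠ 0) :
    ∀ᶠ t in 𝓝[≠] (0 : ℝ), a * t ^ 2 + b * t + c ≠ 0 := by
  have hp : C a * X ^ 2 + C b * X + C c ≠ 0 := by
    intro h0
    have h2 := congrArg (fun q => coeff q 2) h0
    have h1 := congrArg (fun q => coeff q 1) h0
    simp [coeff_C] at h1 h2
    tauto
  have hfin := (finite_setOfPred_isRoot hp).compl_mem_cofinite
  filter_upwards [nhdsNE_le_cofinite (0 : ℝ) hfin] with t ht h0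
  exact ht (by simpa [IsRoot] using h0)

/-- At a regular configuration the differentials can be dependent only on a thin set of momenta:
along the line through any `p` in the direction `1 × x + 1`, the conditions of
`linearIndependent_fderiv_quadraticIntegrals` are nontrivial polynomial ones. -/
lemma functionallyIndependent_quadraticIntegrals {D : Fin 3 → Set (ℝ × ℝ)}
    {F : Fin 3 → ℝ × ℝ → ℝ} (hD : ∀ i, IsOpen (D i)) (hF : ∀ i, ContDiffOn ℝ ∞ (F i) (D i)) :
    FunctionallyIndependent (regularConfigs D) (quadraticIntegrals F) := by
  rintro ⟨x, p⟩ ⟨hx, -⟩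
  have hx : x ∈ regularConfigs D := hx
  have h01 : x 0 - x 1 ≠ 0 := (hx 0).1
  have hsq : 0 < (x 2 - x 1) ^ 2 + (x 0 - x 2) ^ 2 + (x 1 - x 0) ^ 2 := by
    have : 0 < (x 1 - x 0) ^ 2 := by
      rw [sq_pos_iff]; intro h; exact h01 (by linear_combination -h)
    positivity
  let w : Fin 3 → ℝ := ![x 2 - x 1 + 1, x 0 - x 2 + 1, x 1 - x 0 + 1]
  have hline : Tendsto (fun t : ℝ => ((x, p + t • w) : Phase 3)) (𝓝[≠] 0) (𝓝 (x, p)) := by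
    have : Continuous fun t : ℝ => ((x, p + t • w) : Phase 3) := by fun_prop
    have h := this.tendsto 0
    simp only [zero_smul, add_zero] at h
    exact h.mono_left nhdsWithin_le_nhds
  refine mem_closure_of_tendsto hline ?_
  have e1 := eventually_quadratic_ne_zero (a := 0) (b := momentumDet x w) (c := momentumDet x p)
    (Or.inr (by
      have : momentumDet x w = (x 2 - x 1) ^ 2 + (x 0 - x 2) ^ 2 + (x 1 - x 0) ^ 2 := by
        simp [momentumDet, w]; ring
      rw [this]; exact hsq.ne'))
  have e2 := eventually_quadratic_ne_zero (a := 0) (b := 3) (c := totalMomentum (x, p))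
    (Or.inr three_ne_zero)
  have e3 := eventually_quadratic_ne_zero
    (a := ((x 2 - x 1) ^ 2 + (x 0 - x 2) ^ 2 + (x 1 - x 0) ^ 2) / 2)
    (b := ∑ i, p i * w i - totalMomentum (x, p)) (c := relEnergy F (x, p))
    (Or.inl (by positivity))
  filter_upwards [e1, e2, e3] with t h1 h2 h3
  refine ⟨⟨hx, trivial⟩, linearIndependent_fderiv_quadraticIntegrals
    (differentiableAt_potential hD hF hx) h01 ?_ ?_ ?_⟩
  · convert h1 using 1
    simp [momentumDet]; ring
  · convert h2 using 1
    simp [totalMomentum, w, Fin.sum_univ_three]; ring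
  · convert h3 using 1
    simp [relEnergy, hamiltonian, totalMomentum, w, Fin.sum_univ_three]; ring

lemma isLiouvilleIntegrable_hamiltonian {D : Fin 3 → Set (ℝ × ℝ)} {F : Fin 3 → ℝ × ℝ → ℝ}
    (hD : ∀ i, IsOpen (D i)) (hF : ∀ i, ContDiffOn ℝ ∞ (F i) (D i)) :
    IsLiouvilleIntegrable (regularConfigs D) (hamiltonian F) := by
  refine ⟨fun i => quadraticIntegrals F i.castSucc, ⟨0, rfl⟩,
    fun i => isFirstIntegral_quadraticIntegrals hD hF _, fun i j m hm => ?_, ?_⟩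
  · have h10 := poisson_totalMomentum_hamiltonian hD hF hm.1
    have h20 := poisson_angularIntegral_hamiltonian hD hF hm.1
    have h21 := poisson_angularIntegral_totalMomentum hD hF hm.1
    have h01 := (poisson_swap _ _ m).trans (neg_eq_zero.2 h10)
    have h02 := (poisson_swap _ _ m).trans (neg_eq_zero.2 h20)
    have h12 := (poisson_swap _ _ m).trans (neg_eq_zero.2 h21)
    fin_cases i <;> fin_cases j <;> first | exact poisson_self _ m | assumption
  · refine (functionallyIndependent_quadraticIntegrals hD hF).trans (closure_mono ?_)
    exact fun m hm => ⟨hm.1, hm.2.comp Fin.castSucc (Fin.castSucc_injective 3)⟩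

lemma isQuasiMaximallySuperintegrable_hamiltonian {D : Fin 3 → Set (ℝ × ℝ)}
    {F : Fin 3 → ℝ × ℝ → ℝ} (hD : ∀ i, IsOpen (D i)) (hF : ∀ i, ContDiffOn ℝ ∞ (F i) (D i))
    (hnull : volume (regularConfigs D)ᶜ = 0) :
    IsQuasiMaximallySuperintegrable (regularConfigs D) (hamiltonian F) :=
  ⟨⟨isOpen_regularConfigs hD, hnull⟩, isLiouvilleIntegrable_hamiltonian hD hF,
    quadraticIntegrals F, isFirstIntegral_quadraticIntegrals hD hF,
    functionallyIndependent_quadraticIntegrals hD hF⟩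

/-! ### Rotational coordinates -/

/-- The unit vector `∂/∂r` of cylindrical coordinates at the angle `ψ`. -/
def radialVec (ψ : ℝ) : Fin 3 → ℝ := fromCylindrical 1 ψ 0

/-- The unit vector `r⁻¹ ∂/∂ψ` of cylindrical coordinates at the angle `ψ`. -/
def angularVec (ψ : ℝ) : Fin 3 → ℝ := fromCylindrical 1 (ψ + Real.pi / 2) 0

/-- The unit vector `∂/∂z` along the axis `(1, 1, 1)`. -/
def axialVec : Fin 3 → ℝ := fromCylindrical 0 0 1

lemma radialVec_eq (ψ : ℝ) : radialVec ψ = ![Real.cos ψ / √2 + Real.sin ψ / √6,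
    -Real.cos ψ / √2 + Real.sin ψ / √6, -(2 * Real.sin ψ) / √6] := by
  simp [radialVec, fromCylindrical]

lemma angularVec_eq (ψ : ℝ) : angularVec ψ = ![-Real.sin ψ / √2 + Real.cos ψ / √6,
    Real.sin ψ / √2 + Real.cos ψ / √6, -(2 * Real.cos ψ) / √6] := by
  simp [angularVec, fromCylindrical, Real.cos_add_pi_div_two, Real.sin_add_pi_div_two]

lemma axialVec_eq : axialVec = fun _ => 1 / √3 := by
  ext i; fin_cases i <;> simp [axialVec, fromCylindrical]

lemma fromCylindrical_eq (r ψ z : ℝ) :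
    fromCylindrical r ψ z = r • radialVec ψ + z • axialVec := by
  rw [radialVec_eq, axialVec_eq]
  ext i
  fin_cases i <;> simp [fromCylindrical] <;> ring

lemma hasDerivAt_radialVec (ψ : ℝ) : HasDerivAt radialVec (angularVec ψ) ψ := by
  have hc := Real.hasDerivAt_cos ψ
  have hs := Real.hasDerivAt_sin ψ
  have : radialVec = fun ψ => ![Real.cos ψ / √2 + Real.sin ψ / √6,
    -Real.cos ψ / √2 + Real.sin ψ / √6, -(2 * Real.sin ψ) / √6] := funext radialVec_eq
  rw [this, angularVec_eq, hasDerivAt_pi]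
  intro i
  fin_cases i
  · exact (hc.div_const _).add (hs.div_const _)
  · exact ((hc.fun_neg.div_const _).add (hs.div_const _)).congr_deriv (by simp)
  · exact ((hs.const_mul 2).fun_neg.div_const _)

section Frame

lemma inv_sqrt_sq (a : ℝ) (ha : 0 ≤ a) : (√a)⁻¹ ^ 2 = a⁻¹ := by
  rw [inv_pow, Real.sq_sqrt ha]

lemma radialVec_dot_self (ψ : ℝ) : radialVec ψ ⬝ᵥ radialVec ψ = 1 := by
  simp only [radialVec_eq, dotProduct, Fin.sum_univ_three, Matrix.cons_val, div_eq_mul_inv]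
  linear_combination 2 * Real.cos ψ ^ 2 * inv_sqrt_sq 2 (by norm_num) +
    6 * Real.sin ψ ^ 2 * inv_sqrt_sq 6 (by norm_num) + Real.sin_sq_add_cos_sq ψ

lemma angularVec_dot_self (ψ : ℝ) : angularVec ψ ⬝ᵥ angularVec ψ = 1 :=
  radialVec_dot_self (ψ + Real.pi / 2)

lemma axialVec_dot_self : axialVec ⬝ᵥ axialVec = 1 := by
  simp only [axialVec_eq, dotProduct, Fin.sum_univ_three, one_div]
  linear_combination 3 * inv_sqrt_sq 3 (by norm_num)

lemma radialVec_dot_angularVec (ψ : ℝ) : radialVec ψ ⬝ᵥ angularVec ψ = 0 := by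
  simp only [radialVec_eq, angularVec_eq, dotProduct, Fin.sum_univ_three, Matrix.cons_val,
    div_eq_mul_inv]
  linear_combination -2 * Real.cos ψ * Real.sin ψ * inv_sqrt_sq 2 (by norm_num) +
    6 * Real.sin ψ * Real.cos ψ * inv_sqrt_sq 6 (by norm_num)

lemma radialVec_dot_axialVec (ψ : ℝ) : radialVec ψ ⬝ᵥ axialVec = 0 := by
  simp only [radialVec_eq, axialVec_eq, dotProduct, Fin.sum_univ_three, Matrix.cons_val]
  ring

lemma angularVec_dot_axialVec (ψ : ℝ) : angularVec ψ ⬝ᵥ axialVec = 0 :=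
  radialVec_dot_axialVec _

/-- Parseval's identity for the orthonormal frame of cylindrical coordinates. -/
lemma sum_sq_eq_frame (ψ : ℝ) (p : Fin 3 → ℝ) : ∑ i, p i ^ 2 =
    (p ⬝ᵥ radialVec ψ) ^ 2 + (p ⬝ᵥ angularVec ψ) ^ 2 + (p ⬝ᵥ axialVec) ^ 2 := by
  simp only [radialVec_eq, angularVec_eq, axialVec_eq, dotProduct, Fin.sum_univ_three,
    Matrix.cons_val, div_eq_mul_inv]
  linear_combination (-(p 0 - p 1) ^ 2) * inv_sqrt_sq 2 (by norm_num) -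
    (p 0 + p 1 - 2 * p 2) ^ 2 * inv_sqrt_sq 6 (by norm_num) -
    (p 0 + p 1 + p 2) ^ 2 * inv_sqrt_sq 3 (by norm_num) -
    ((p 0 - p 1) ^ 2 * (√2)⁻¹ ^ 2 + (p 0 + p 1 - 2 * p 2) ^ 2 * (√6)⁻¹ ^ 2) *
      Real.sin_sq_add_cos_sq ψ

end Frame

/-- The angular part of the potential, `r² V` as a function of the angle. -/
def angularPotential (F : Fin 3 → ℝ × ℝ → ℝ) (ψ : ℝ) : ℝ := potential F (radialVec ψ)

lemma smul_axialVec (z : ℝ) : z • axialVec = fun _ => z / √3 := by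
  rw [axialVec_eq]; ext i; simp [div_eq_mul_inv]

lemma potential_fromCylindrical (F : Fin 3 → ℝ × ℝ → ℝ) {r : ℝ} (hr : r ≠ 0) (ψ z : ℝ) :
    potential F (fromCylindrical r ψ z) = angularPotential F ψ / r ^ 2 := by
  rw [fromCylindrical_eq, smul_axialVec, potential_smul_add _ _ hr, angularPotential]

lemma fromCylindrical_mem_iff {D : Fin 3 → Set (ℝ × ℝ)} {r : ℝ} (hr : r ≠ 0) (ψ z : ℝ) :
    fromCylindrical r ψ z ∈ regularConfigs D ↔ radialVec ψ ∈ regularConfigs D := by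
  rw [fromCylindrical_eq, smul_axialVec, mem_regularConfigs_smul_add hr]

lemma contDiff_radialVec : ContDiff ℝ ∞ radialVec := by
  have : radialVec = fun ψ => ![Real.cos ψ / √2 + Real.sin ψ / √6,
    -Real.cos ψ / √2 + Real.sin ψ / √6, -(2 * Real.sin ψ) / √6] := funext radialVec_eq
  rw [this, contDiff_pi]
  intro i
  fin_cases i
  · exact (Real.contDiff_cos.div_const _).add (Real.contDiff_sin.div_const _)
  · exact (Real.contDiff_cos.neg.div_const _).add (Real.contDiff_sin.div_const _)
  · exact (contDiff_const.mul Real.contDiff_sin).neg.div_const _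

/-- A coordinate vector is the velocity of the coordinate line. -/
lemma coordVec_eq_of_hasDerivAt {n : ℕ} {Φ : (Fin n → ℝ) → (Fin n → ℝ)} {q : Fin n → ℝ}
    (hΦ : DifferentiableAt ℝ Φ q) {i : Fin n} {v : Fin n → ℝ}
    (h : HasDerivAt (fun t => Φ (Function.update q i t)) v (q i)) : coordVec Φ q i = v := by
  have h1 : HasFDerivAt Φ (fderiv ℝ Φ q) (Function.update q i (q i)) := by
    rw [Function.update_eq_self]; exact hΦ.hasFDerivAt
  exact (h1.comp_hasDerivAt (q i) (hasDerivAt_update q i (q i))).unique h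

section RotChart

variable {z₀ : ℝ} {R Z : ℝ → ℝ → ℝ}

lemma rotChart_eq (q : Fin 3 → ℝ) : rotChart z₀ R Z q =
    R (q 0) (q 1) • radialVec (q 2) + (z₀ + Z (q 0) (q 1)) • axialVec :=
  fromCylindrical_eq _ _ _

lemma contDiff_rotChart (hR : ContDiff ℝ ∞ fun q : Fin 3 → ℝ => R (q 0) (q 1))
    (hZ : ContDiff ℝ ∞ fun q : Fin 3 → ℝ => Z (q 0) (q 1)) : ContDiff ℝ ∞ (rotChart z₀ R Z) := by
  rw [funext rotChart_eq]
  exact (hR.smul (contDiff_radialVec.comp (by fun_prop))).add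
    ((contDiff_const.add hZ).smul contDiff_const)

variable {q : Fin 3 → ℝ}

lemma coordVec_rotChart_zero (h : DifferentiableAt ℝ (rotChart z₀ R Z) q) {a b : ℝ}
    (hR : HasDerivAt (fun u => R u (q 1)) a (q 0))
    (hZ : HasDerivAt (fun u => Z u (q 1)) b (q 0)) :
    coordVec (rotChart z₀ R Z) q 0 = a • radialVec (q 2) + b • axialVec := by
  refine coordVec_eq_of_hasDerivAt h ?_
  simpa [rotChart_eq] using (hR.smul_const (radialVec (q 2))).fun_add
    ((hZ.const_add z₀).smul_const axialVec)

lemma coordVec_rotChart_one (h : DifferentiableAt ℝ (rotChart z₀ R Z) q) {a b : ℝ}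
    (hR : HasDerivAt (fun v => R (q 0) v) a (q 1))
    (hZ : HasDerivAt (fun v => Z (q 0) v) b (q 1)) :
    coordVec (rotChart z₀ R Z) q 1 = a • radialVec (q 2) + b • axialVec := by
  refine coordVec_eq_of_hasDerivAt h ?_
  simpa [rotChart_eq] using (hR.smul_const (radialVec (q 2))).fun_add
    ((hZ.const_add z₀).smul_const axialVec)

lemma coordVec_rotChart_two (h : DifferentiableAt ℝ (rotChart z₀ R Z) q) :
    coordVec (rotChart z₀ R Z) q 2 = R (q 0) (q 1) • angularVec (q 2) := by
  refine coordVec_eq_of_hasDerivAt h ?_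
  simpa [rotChart_eq] using ((hasDerivAt_radialVec (q 2)).const_smul (R (q 0) (q 1))).add_const
    ((z₀ + Z (q 0) (q 1)) • axialVec)

end RotChart

/-- Parseval's identity in the plane, for an orthogonal basis `(a, b)`, `(c, d)`. -/
lemma sq_add_sq_eq_of_orthogonal {a b c d : ℝ} (x y : ℝ) (h : a * c + b * d = 0)
    (h₁ : a ^ 2 + b ^ 2 ≠ 0) (h₂ : c ^ 2 + d ^ 2 ≠ 0) :
    (a * x + b * y) ^ 2 / (a ^ 2 + b ^ 2) + (c * x + d * y) ^ 2 / (c ^ 2 + d ^ 2) =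
      x ^ 2 + y ^ 2 := by
  rw [div_add_div _ _ h₁ h₂, div_eq_iff (mul_ne_zero h₁ h₂)]
  linear_combination ((x ^ 2 - y ^ 2) * (a * c - b * d) + 2 * x * y * (b * c + a * d)) * h

/-- Separation in rotational coordinates. The metric is
`g_u du² + g_v dv² + R² dψ²` and the potential is `G(ψ) / R²`, so that the equation
`(W₃')² + 2 G = c₃` splits off. The remaining equation
`(W₁')² / g_u + (W₂')² / g_v + c₃ / R² = 2 c₁` separates if `g_u`, `g_v`, `R²` are related to the
rows `S`, `T` (depending on `u` and on `v`, respectively) of a Stäckel matrix. -/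
theorem isSeparableIn_rotChart {D : Fin 3 → Set (ℝ × ℝ)} {F : Fin 3 → ℝ × ℝ → ℝ}
    (hD : ∀ i, IsOpen (D i)) (hF : ∀ i, ContDiffOn ℝ ∞ (F i) (D i)) (z₀ : ℝ)
    {R Z Ru Rv Zu Zv gu gv : ℝ → ℝ → ℝ} {Q : Set (Fin 3 → ℝ)} (hQ : IsOpen Q)
    (hR : ContDiff ℝ ∞ fun q : Fin 3 → ℝ => R (q 0) (q 1))
    (hZ : ContDiff ℝ ∞ fun q : Fin 3 → ℝ => Z (q 0) (q 1))
    (hRu : ∀ u v, HasDerivAt (fun u => R u v) (Ru u v) u)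
    (hRv : ∀ u v, HasDerivAt (fun v => R u v) (Rv u v) v)
    (hZu : ∀ u v, HasDerivAt (fun u => Z u v) (Zu u v) u)
    (hZv : ∀ u v, HasDerivAt (fun v => Z u v) (Zv u v) v)
    (hgu : ∀ u v, Ru u v ^ 2 + Zu u v ^ 2 = gu u v)
    (hgv : ∀ u v, Rv u v ^ 2 + Zv u v ^ 2 = gv u v)
    (horth : ∀ u v, Ru u v * Rv u v + Zu u v * Zv u v = 0)
    (S T : Fin 3 → ℝ → ℝ)
    (hS : ∀ q ∈ Q, ∀ j, ContDiffAt ℝ ∞ (S j) (q 0))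
    (hT : ∀ q ∈ Q, ∀ j, ContDiffAt ℝ ∞ (T j) (q 1))
    (hstaeckel : ∀ q ∈ Q, R (q 0) (q 1) ≠ 0 ∧ gu (q 0) (q 1) ≠ 0 ∧ gv (q 0) (q 1) ≠ 0 ∧
      S 0 (q 0) * T 1 (q 1) - S 1 (q 0) * T 0 (q 1) ≠ 0 ∧
      S 0 (q 0) / gu (q 0) (q 1) + T 0 (q 1) / gv (q 0) (q 1) = 2 ∧
      S 1 (q 0) / gu (q 0) (q 1) + T 1 (q 1) / gv (q 0) (q 1) = 0 ∧
      S 2 (q 0) / gu (q 0) (q 1) + T 2 (q 1) / gv (q 0) (q 1) + 1 / R (q 0) (q 1) ^ 2 = 0) :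
    IsSeparableIn (regularConfigs D) (hamiltonian F) Q (rotChart z₀ R Z) := by
  have hΦ : ContDiff ℝ ∞ (rotChart z₀ R Z) := contDiff_rotChart hR hZ
  have hd : ∀ q, DifferentiableAt ℝ (rotChart z₀ R Z) q :=
    fun q => hΦ.contDiffAt.differentiableAt (by simp)
  have h0 := fun q : Fin 3 → ℝ => coordVec_rotChart_zero (hd q) (hRu (q 0) (q 1)) (hZu (q 0) (q 1))
  have h1 := fun q : Fin 3 → ℝ => coordVec_rotChart_one (hd q) (hRv (q 0) (q 1)) (hZv (q 0) (q 1))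
  have h2 := fun q : Fin 3 → ℝ => coordVec_rotChart_two (hd q)
  -- The Gram matrix of the coordinate vectors.
  have g00 : ∀ q, coordVec (rotChart z₀ R Z) q 0 ⬝ᵥ coordVec (rotChart z₀ R Z) q 0 =
      gu (q 0) (q 1) := by
    intro q
    rw [h0]
    simp only [add_dotProduct, dotProduct_add, smul_dotProduct, dotProduct_smul, smul_eq_mul,
      radialVec_dot_self, axialVec_dot_self, radialVec_dot_axialVec,
      dotProduct_comm axialVec (radialVec _)]
    rw [← hgu]; ring
  have g11 : ∀ q, coordVec (rotChart z₀ R Z) q 1 ⬝ᵥ coordVec (rotChart z₀ R Z) q 1 =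
      gv (q 0) (q 1) := by
    intro q
    rw [h1]
    simp only [add_dotProduct, dotProduct_add, smul_dotProduct, dotProduct_smul, smul_eq_mul,
      radialVec_dot_self, axialVec_dot_self, radialVec_dot_axialVec,
      dotProduct_comm axialVec (radialVec _)]
    rw [← hgv]; ring
  have g22 : ∀ q, coordVec (rotChart z₀ R Z) q 2 ⬝ᵥ coordVec (rotChart z₀ R Z) q 2 =
      R (q 0) (q 1) ^ 2 := by
    intro q
    rw [h2]
    simp only [smul_dotProduct, dotProduct_smul, smul_eq_mul, angularVec_dot_self]
    ring
  have g01 : ∀ q, coordVec (rotChart z₀ R Z) q 0 ⬝ᵥ coordVec (rotChart z₀ R Z) q 1 = 0 := by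
    intro q
    rw [h0, h1]
    simp only [add_dotProduct, dotProduct_add, smul_dotProduct, dotProduct_smul, smul_eq_mul,
      radialVec_dot_self, axialVec_dot_self, radialVec_dot_axialVec,
      dotProduct_comm axialVec (radialVec _)]
    linear_combination horth (q 0) (q 1)
  have g02 : ∀ q, coordVec (rotChart z₀ R Z) q 0 ⬝ᵥ coordVec (rotChart z₀ R Z) q 2 = 0 := by
    intro q
    rw [h0, h2]
    simp [radialVec_dot_angularVec, dotProduct_comm axialVec (angularVec _),
      angularVec_dot_axialVec]
  have g12 : ∀ q, coordVec (rotChart z₀ R Z) q 1 ⬝ᵥ coordVec (rotChart z₀ R Z) q 2 = 0 := by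
    intro q
    rw [h1, h2]
    simp [radialVec_dot_angularVec, dotProduct_comm axialVec (angularVec _),
      angularVec_dot_axialVec]
  have hortho : IsOrthogonalCoordinates Q (rotChart z₀ R Z) := by
    refine ⟨hQ, hΦ.contDiffOn, fun q hq => ⟨fun i hi => ?_, fun i j hij => ?_⟩⟩
    · obtain ⟨hr, hu, hv, -⟩ := hstaeckel q hq
      fin_cases i
      · exact hu (by rw [← g00 q]; simp [show coordVec (rotChart z₀ R Z) q 0 = 0 from hi])
      · exact hv (by rw [← g11 q]; simp [show coordVec (rotChart z₀ R Z) q 1 = 0 from hi])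
      · exact pow_ne_zero 2 hr (by
          rw [← g22 q]; simp [show coordVec (rotChart z₀ R Z) q 2 = 0 from hi])
    · have g10 := (dotProduct_comm _ _).trans (g01 q)
      have g20 := (dotProduct_comm _ _).trans (g02 q)
      have g21 := (dotProduct_comm _ _).trans (g12 q)
      have g01 := g01 q
      have g02 := g02 q
      have g12 := g12 q
      fin_cases i <;> fin_cases j <;> first | exact absurd rfl hij | assumption
  refine isSeparableIn_of_staeckel (isOpen_regularConfigs hD) hortho
    ![S, T, ![fun _ => 0, fun _ => 0, fun _ => 1]]
    ![fun _ => 0, fun _ => 0, fun ψ => -2 * angularPotential F ψ]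
    ![fun q => 1 / (2 * gu (q 0) (q 1)), fun q => 1 / (2 * gv (q 0) (q 1)),
      fun q => 1 / (2 * R (q 0) (q 1) ^ 2)] ?_ ?_ ?_ ?_ ?_
  · intro q hq _ i j
    fin_cases i
    · exact hS q hq j
    · exact hT q hq j
    · fin_cases j <;> exact contDiffAt_const
  · intro q hq hqΩ i
    fin_cases i
    · exact contDiffAt_const
    · exact contDiffAt_const
    · have hmem : radialVec (q 2) ∈ regularConfigs D :=
        (fromCylindrical_mem_iff (hstaeckel q hq).1 _ _).1 hqΩ
      exact contDiffAt_const.mul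
        ((contDiffAt_potential hD hF hmem).comp (q 2) contDiff_radialVec.contDiffAt)
  · intro q hq
    obtain ⟨-, -, -, hdet, -⟩ := hstaeckel q hq
    rw [Matrix.det_fin_three]
    simpa using hdet
  · intro q hq j
    obtain ⟨hr, hu, hv, -, e0, e1, e2⟩ := hstaeckel q hq
    rw [Fin.sum_univ_three]
    fin_cases j <;> simp
    · linear_combination e0 / 2
    · linear_combination e1 / 2
    · linear_combination e2 / 2
  · intro q hq _ p
    obtain ⟨hr, hu, hv, -⟩ := hstaeckel q hq
    have hpot : potential F (rotChart z₀ R Z q) =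
        angularPotential F (q 2) / R (q 0) (q 1) ^ 2 := potential_fromCylindrical F hr _ _
    have hA : (p ⬝ᵥ coordVec (rotChart z₀ R Z) q 0) ^ 2 / gu (q 0) (q 1) +
        (p ⬝ᵥ coordVec (rotChart z₀ R Z) q 1) ^ 2 / gv (q 0) (q 1) =
        (p ⬝ᵥ radialVec (q 2)) ^ 2 + (p ⬝ᵥ axialVec) ^ 2 := by
      rw [h0, h1]
      simp only [dotProduct_add, dotProduct_smul, smul_eq_mul]
      rw [← hgu] at hu ⊢
      rw [← hgv] at hv ⊢
      exact sq_add_sq_eq_of_orthogonal _ _ (horth (q 0) (q 1)) hu hv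
    have hB : (p ⬝ᵥ coordVec (rotChart z₀ R Z) q 2) ^ 2 / R (q 0) (q 1) ^ 2 =
        (p ⬝ᵥ angularVec (q 2)) ^ 2 := by
      rw [h2, dotProduct_smul, smul_eq_mul, mul_pow, mul_div_cancel_left₀ _ (pow_ne_zero 2 hr)]
    rw [Fin.sum_univ_three]
    simp only [hamiltonian, hpot, sum_sq_eq_frame (q 2) p, Matrix.cons_val]
    linear_combination -hA / 2 - hB / 2

/-! ### The five coordinate systems -/

section Charts

variable {D : Fin 3 → Set (ℝ × ℝ)} {F : Fin 3 → ℝ × ℝ → ℝ}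

lemma isOpen_domSpherical : IsOpen domSpherical :=
  (isOpen_lt continuous_const (continuous_apply 0)).inter
    ((isOpen_lt continuous_const (continuous_apply 1)).inter
      (isOpen_lt (continuous_apply 1) continuous_const))

/-- The separated equations are `(W₁')² = c₂ - c₃ / u²` and `(W₂')² = 2 c₁ - c₂`. -/
theorem isSeparableIn_cylindricalChart (hD : ∀ i, IsOpen (D i))
    (hF : ∀ i, ContDiffOn ℝ ∞ (F i) (D i)) (z₀ : ℝ) :
    IsSeparableIn (regularConfigs D) (hamiltonian F) domCylindrical (cylindricalChart z₀) := by
  refine isSeparableIn_rotChart hD hF z₀ (Ru := fun _ _ => 1) (Rv := fun _ _ => 0)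
    (Zu := fun _ _ => 0) (Zv := fun _ _ => 1) (gu := fun _ _ => 1) (gv := fun _ _ => 1)
    (isOpen_lt continuous_const (continuous_apply 0)) (by fun_prop) (by fun_prop)
    (fun u _ => hasDerivAt_id u) (fun _ v => hasDerivAt_const v _) (fun u _ => hasDerivAt_const u _)
    (fun _ v => hasDerivAt_id v) (by simp) (by simp) (by simp)
    ![fun _ => 0, fun _ => 1, fun u => -1 / u ^ 2] ![fun _ => 2, fun _ => -1, fun _ => 0] ?_ ?_ ?_
  · intro q hq j
    have hu : q 0 ≠ 0 := (show 0 < q 0 from hq).ne'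
    fin_cases j
    · exact contDiffAt_const
    · exact contDiffAt_const
    · exact contDiffAt_const.div (by fun_prop) (pow_ne_zero 2 hu)
  · intro q _ j
    fin_cases j <;> exact contDiffAt_const
  · intro q hq
    have hu : q 0 ≠ 0 := (show 0 < q 0 from hq).ne'
    refine ⟨hu, one_ne_zero, one_ne_zero, ?_, ?_, ?_, ?_⟩ <;> simp
    field_simp
    ring

/-- The separated equations are `(W₁')² = 2 c₁ - c₂ / u²` and `(W₂')² = c₂ - c₃ / sin² v`. -/
theorem isSeparableIn_sphericalChart (hD : ∀ i, IsOpen (D i))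
    (hF : ∀ i, ContDiffOn ℝ ∞ (F i) (D i)) (z₀ : ℝ) :
    IsSeparableIn (regularConfigs D) (hamiltonian F) domSpherical (sphericalChart z₀) := by
  refine isSeparableIn_rotChart hD hF z₀ (Ru := fun _ v => Real.sin v)
    (Rv := fun u v => u * Real.cos v) (Zu := fun _ v => Real.cos v)
    (Zv := fun u v => u * -Real.sin v) (gu := fun _ _ => 1) (gv := fun u _ => u ^ 2)
    isOpen_domSpherical (by fun_prop) (by fun_prop)
    (fun u v => by simpa using (hasDerivAt_id u).mul_const (Real.sin v))
    (fun u v => (Real.hasDerivAt_sin v).const_mul u)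
    (fun u v => by simpa using (hasDerivAt_id u).mul_const (Real.cos v))
    (fun u v => (Real.hasDerivAt_cos v).const_mul u)
    (fun _ v => Real.sin_sq_add_cos_sq v)
    (fun u v => by linear_combination u ^ 2 * Real.sin_sq_add_cos_sq v)
    (fun u v => by ring)
    ![fun _ => 2, fun u => -1 / u ^ 2, fun _ => 0]
    ![fun _ => 0, fun _ => 1, fun v => -1 / Real.sin v ^ 2] ?_ ?_ ?_
  · intro q hq j
    have hu : q 0 ≠ 0 := hq.1.ne'
    fin_cases j
    · exact contDiffAt_const
    · exact contDiffAt_const.div (by fun_prop) (pow_ne_zero 2 hu)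
    · exact contDiffAt_const
  · intro q hq j
    have hs : Real.sin (q 1) ≠ 0 := (Real.sin_pos_of_pos_of_lt_pi hq.2.1 hq.2.2).ne'
    fin_cases j
    · exact contDiffAt_const
    · exact contDiffAt_const
    · exact contDiffAt_const.div (Real.contDiff_sin.contDiffAt.pow 2) (pow_ne_zero 2 hs)
  · intro q hq
    have hu : q 0 ≠ 0 := hq.1.ne'
    have hs : Real.sin (q 1) ≠ 0 := (Real.sin_pos_of_pos_of_lt_pi hq.2.1 hq.2.2).ne'
    refine ⟨mul_ne_zero hu hs, one_ne_zero, pow_ne_zero 2 hu, ?_, ?_, ?_, ?_⟩ <;> simp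
    · field_simp
      ring
    · field_simp
      ring

/-- The separated equations are `(W₁')² = 2 c₁ u² + c₂ - c₃ / u²` and
`(W₂')² = 2 c₁ v² - c₂ - c₃ / v²`. -/
theorem isSeparableIn_parabolicChart (hD : ∀ i, IsOpen (D i))
    (hF : ∀ i, ContDiffOn ℝ ∞ (F i) (D i)) (z₀ : ℝ) :
    IsSeparableIn (regularConfigs D) (hamiltonian F) domParabolic (parabolicChart z₀) := by
  refine isSeparableIn_rotChart hD hF z₀ (Ru := fun _ v => v) (Rv := fun u _ => u)
    (Zu := fun u _ => u) (Zv := fun _ v => -v) (gu := fun u v => u ^ 2 + v ^ 2)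
    (gv := fun u v => u ^ 2 + v ^ 2)
    ((isOpen_lt continuous_const (continuous_apply 0)).inter
      (isOpen_lt continuous_const (continuous_apply 1))) (by fun_prop) (by fun_prop)
    (fun u v => by simpa using (hasDerivAt_id u).mul_const v)
    (fun u v => by simpa using (hasDerivAt_id v).const_mul u)
    (fun u v => (((hasDerivAt_pow 2 u).sub_const (v ^ 2)).div_const 2).congr_deriv (by simp))
    (fun u v => (((hasDerivAt_pow 2 v).const_sub (u ^ 2)).div_const 2).congr_deriv
      (by simp; ring))
    (fun u v => by ring) (fun u v => by ring) (fun u v => by ring)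
    ![fun u => 2 * u ^ 2, fun _ => 1, fun u => -1 / u ^ 2]
    ![fun v => 2 * v ^ 2, fun _ => -1, fun v => -1 / v ^ 2] ?_ ?_ ?_
  · intro q hq j
    have hu : q 0 ≠ 0 := hq.1.ne'
    fin_cases j
    · show ContDiffAt ℝ ∞ (fun u : ℝ => 2 * u ^ 2) _
      fun_prop
    · exact contDiffAt_const
    · exact contDiffAt_const.div (by fun_prop) (pow_ne_zero 2 hu)
  · intro q hq j
    have hv : q 1 ≠ 0 := hq.2.ne'
    fin_cases j
    · show ContDiffAt ℝ ∞ (fun v : ℝ => 2 * v ^ 2) _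
      fun_prop
    · exact contDiffAt_const
    · exact contDiffAt_const.div (by fun_prop) (pow_ne_zero 2 hv)
  · intro q hq
    have hu : q 0 ≠ 0 := hq.1.ne'
    have hv : q 1 ≠ 0 := hq.2.ne'
    have hg : q 0 ^ 2 + q 1 ^ 2 ≠ 0 := by positivity
    refine ⟨mul_ne_zero hu hv, hg, hg, ?_, ?_, ?_, ?_⟩ <;> simp
    · intro h
      exact hg (by linear_combination -h / 2)
    · field_simp
    · field_simp
      ring
    · field_simp
      ring

/-- The separated equations are `(W₁')² = 2 c₁ a² sinh² u + c₂ - c₃ / sinh² u` and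
`(W₂')² = 2 c₁ a² sin² v - c₂ - c₃ / sin² v`. -/
theorem isSeparableIn_prolateChart (hD : ∀ i, IsOpen (D i))
    (hF : ∀ i, ContDiffOn ℝ ∞ (F i) (D i)) {a : ℝ} (ha : 0 < a) (z₀ : ℝ) :
    IsSeparableIn (regularConfigs D) (hamiltonian F) domSpherical (prolateChart a z₀) := by
  refine isSeparableIn_rotChart hD hF z₀ (Ru := fun u v => a * Real.cosh u * Real.sin v)
    (Rv := fun u v => a * Real.sinh u * Real.cos v)
    (Zu := fun u v => a * Real.sinh u * Real.cos v)
    (Zv := fun u v => a * Real.cosh u * -Real.sin v)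
    (gu := fun u v => a ^ 2 * (Real.sinh u ^ 2 + Real.sin v ^ 2))
    (gv := fun u v => a ^ 2 * (Real.sinh u ^ 2 + Real.sin v ^ 2))
    isOpen_domSpherical (by fun_prop) (by fun_prop)
    (fun u v => ((Real.hasDerivAt_sinh u).const_mul a).mul_const _)
    (fun u v => (Real.hasDerivAt_sin v).const_mul _)
    (fun u v => ((Real.hasDerivAt_cosh u).const_mul a).mul_const _)
    (fun u v => (Real.hasDerivAt_cos v).const_mul _)
    (fun u v => by
      linear_combination a ^ 2 * Real.sin v ^ 2 * Real.cosh_sq u +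
        a ^ 2 * Real.sinh u ^ 2 * Real.sin_sq_add_cos_sq v)
    (fun u v => by
      linear_combination a ^ 2 * Real.sin v ^ 2 * Real.cosh_sq u +
        a ^ 2 * Real.sinh u ^ 2 * Real.sin_sq_add_cos_sq v)
    (fun u v => by ring)
    ![fun u => 2 * a ^ 2 * Real.sinh u ^ 2, fun _ => 1, fun u => -1 / Real.sinh u ^ 2]
    ![fun v => 2 * a ^ 2 * Real.sin v ^ 2, fun _ => -1, fun v => -1 / Real.sin v ^ 2] ?_ ?_ ?_
  · intro q hq j
    have hu : Real.sinh (q 0) ≠ 0 := (Real.sinh_pos_iff.2 hq.1).ne'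
    fin_cases j
    · show ContDiffAt ℝ ∞ (fun u : ℝ => 2 * a ^ 2 * Real.sinh u ^ 2) _
      fun_prop
    · exact contDiffAt_const
    · exact contDiffAt_const.div (Real.contDiff_sinh.contDiffAt.pow 2) (pow_ne_zero 2 hu)
  · intro q hq j
    have hs : Real.sin (q 1) ≠ 0 := (Real.sin_pos_of_pos_of_lt_pi hq.2.1 hq.2.2).ne'
    fin_cases j
    · show ContDiffAt ℝ ∞ (fun v : ℝ => 2 * a ^ 2 * Real.sin v ^ 2) _
      fun_prop
    · exact contDiffAt_const
    · exact contDiffAt_const.div (Real.contDiff_sin.contDiffAt.pow 2) (pow_ne_zero 2 hs)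
  · intro q hq
    have hu : Real.sinh (q 0) ≠ 0 := (Real.sinh_pos_iff.2 hq.1).ne'
    have hs : Real.sin (q 1) ≠ 0 := (Real.sin_pos_of_pos_of_lt_pi hq.2.1 hq.2.2).ne'
    have hg : Real.sinh (q 0) ^ 2 + Real.sin (q 1) ^ 2 ≠ 0 := by positivity
    have hg' : a ^ 2 * (Real.sinh (q 0) ^ 2 + Real.sin (q 1) ^ 2) ≠ 0 := by positivity
    refine ⟨by positivity, hg', hg', ?_, ?_, ?_, ?_⟩ <;>
      simp only [Matrix.cons_val]
    · intro h
      exact hg' (by linear_combination -h / 2)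
    · field_simp
    · ring
    · field_simp
      ring

/-- The separated equations are `(W₁')² = 2 c₁ a² cosh² u + c₂ + c₃ / cosh² u` and
`(W₂')² = -2 c₁ a² sin² v - c₂ - c₃ / sin² v`. -/
theorem isSeparableIn_oblateChart (hD : ∀ i, IsOpen (D i))
    (hF : ∀ i, ContDiffOn ℝ ∞ (F i) (D i)) {a : ℝ} (ha : 0 < a) (z₀ : ℝ) :
    IsSeparableIn (regularConfigs D) (hamiltonian F) domSpherical (oblateChart a z₀) := by
  refine isSeparableIn_rotChart hD hF z₀ (Ru := fun u v => a * Real.sinh u * Real.sin v)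
    (Rv := fun u v => a * Real.cosh u * Real.cos v)
    (Zu := fun u v => a * Real.cosh u * Real.cos v)
    (Zv := fun u v => a * Real.sinh u * -Real.sin v)
    (gu := fun u v => a ^ 2 * (Real.cosh u ^ 2 - Real.sin v ^ 2))
    (gv := fun u v => a ^ 2 * (Real.cosh u ^ 2 - Real.sin v ^ 2))
    isOpen_domSpherical (by fun_prop) (by fun_prop)
    (fun u v => ((Real.hasDerivAt_cosh u).const_mul a).mul_const _)
    (fun u v => (Real.hasDerivAt_sin v).const_mul _)
    (fun u v => ((Real.hasDerivAt_sinh u).const_mul a).mul_const _)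
    (fun u v => (Real.hasDerivAt_cos v).const_mul _)
    (fun u v => by
      linear_combination -a ^ 2 * Real.sin v ^ 2 * Real.cosh_sq u +
        a ^ 2 * Real.cosh u ^ 2 * Real.sin_sq_add_cos_sq v)
    (fun u v => by
      linear_combination -a ^ 2 * Real.sin v ^ 2 * Real.cosh_sq u +
        a ^ 2 * Real.cosh u ^ 2 * Real.sin_sq_add_cos_sq v)
    (fun u v => by ring)
    ![fun u => 2 * a ^ 2 * Real.cosh u ^ 2, fun _ => 1, fun u => 1 / Real.cosh u ^ 2]
    ![fun v => -(2 * a ^ 2 * Real.sin v ^ 2), fun _ => -1, fun v => -1 / Real.sin v ^ 2] ?_ ?_ ?_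
  · intro q hq j
    have hu : Real.cosh (q 0) ≠ 0 := (Real.cosh_pos _).ne'
    fin_cases j
    · show ContDiffAt ℝ ∞ (fun u : ℝ => 2 * a ^ 2 * Real.cosh u ^ 2) _
      fun_prop
    · exact contDiffAt_const
    · exact contDiffAt_const.div (Real.contDiff_cosh.contDiffAt.pow 2) (pow_ne_zero 2 hu)
  · intro q hq j
    have hs : Real.sin (q 1) ≠ 0 := (Real.sin_pos_of_pos_of_lt_pi hq.2.1 hq.2.2).ne'
    fin_cases j
    · show ContDiffAt ℝ ∞ (fun v : ℝ => -(2 * a ^ 2 * Real.sin v ^ 2)) _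
      fun_prop
    · exact contDiffAt_const
    · exact contDiffAt_const.div (Real.contDiff_sin.contDiffAt.pow 2) (pow_ne_zero 2 hs)
  · intro q hq
    have hu : Real.cosh (q 0) ≠ 0 := (Real.cosh_pos _).ne'
    have hs : Real.sin (q 1) ≠ 0 := (Real.sin_pos_of_pos_of_lt_pi hq.2.1 hq.2.2).ne'
    -- `cosh² u - sin² v = sinh² u + cos² v`, and `sinh u > 0`.
    have hg : Real.cosh (q 0) ^ 2 - Real.sin (q 1) ^ 2 ≠ 0 := by
      have h1 := Real.cosh_sq (q 0)
      have h2 := Real.sin_sq_add_cos_sq (q 1)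
      have h3 := pow_pos (Real.sinh_pos_iff.2 hq.1) 2
      have h4 := sq_nonneg (Real.cos (q 1))
      exact (by linarith : 0 < Real.cosh (q 0) ^ 2 - Real.sin (q 1) ^ 2).ne'
    have hg' : a ^ 2 * (Real.cosh (q 0) ^ 2 - Real.sin (q 1) ^ 2) ≠ 0 :=
      mul_ne_zero (by positivity) hg
    refine ⟨by positivity, hg', hg', ?_, ?_, ?_, ?_⟩ <;>
      simp only [Matrix.cons_val]
    · intro h
      exact hg' (by linear_combination -h / 2)
    · field_simp
      ring
    · ring
    · field_simp
      ring

end Charts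

end ThreeBody

end

theorem theorem4 (D : Fin 3 → Set (ℝ × ℝ)) (F : Fin 3 → ℝ × ℝ → ℝ)
    (hD : ∀ i, IsOpen (D i)) (hF : ∀ i, ContDiffOn ℝ ∞ (F i) (D i))
    (hnull : volume (ThreeBody.regularConfigs D)ᶜ = 0) :
    ThreeBody.IsQuasiMaximallySuperintegrable
      (ThreeBody.regularConfigs D) (ThreeBody.hamiltonian F) ∧
    (∃ f : Fin 4 → ThreeBody.Phase 3 → ℝ,
      f 0 = ThreeBody.hamiltonian F ∧
      (∀ i, ThreeBody.IsFirstIntegral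
        (ThreeBody.regularConfigs D) (ThreeBody.hamiltonian F) (f i)) ∧
      (∀ i, ThreeBody.IsQuadratic (ThreeBody.regularConfigs D) (f i)) ∧
      ThreeBody.FunctionallyIndependent (ThreeBody.regularConfigs D) f) ∧
    (∀ z₀ : ℝ,
      ThreeBody.IsSeparableIn (ThreeBody.regularConfigs D) (ThreeBody.hamiltonian F)
        ThreeBody.domCylindrical (ThreeBody.cylindricalChart z₀) ∧
      ThreeBody.IsSeparableIn (ThreeBody.regularConfigs D) (ThreeBody.hamiltonian F)
        ThreeBody.domSpherical (ThreeBody.sphericalChart z₀) ∧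
      ThreeBody.IsSeparableIn (ThreeBody.regularConfigs D) (ThreeBody.hamiltonian F)
        ThreeBody.domParabolic (ThreeBody.parabolicChart z₀) ∧
      ∀ a : ℝ, 0 < a →
        ThreeBody.IsSeparableIn (ThreeBody.regularConfigs D) (ThreeBody.hamiltonian F)
          ThreeBody.domSpherical (ThreeBody.prolateChart a z₀) ∧
        ThreeBody.IsSeparableIn (ThreeBody.regularConfigs D) (ThreeBody.hamiltonian F)
          ThreeBody.domSpherical (ThreeBody.oblateChart a z₀)) := by
  exact ⟨ThreeBody.isQuasiMaximallySuperintegrable_hamiltonian hD hF hnull,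
    ⟨ThreeBody.quadraticIntegrals F, rfl, ThreeBody.isFirstIntegral_quadraticIntegrals hD hF,
      ThreeBody.isQuadratic_quadraticIntegrals hF,
      ThreeBody.functionallyIndependent_quadraticIntegrals hD hF⟩,
    fun z₀ => ⟨ThreeBody.isSeparableIn_cylindricalChart hD hF z₀,
      ThreeBody.isSeparableIn_sphericalChart hD hF z₀,
      ThreeBody.isSeparableIn_parabolicChart hD hF z₀, fun _ ha =>
        ⟨ThreeBody.isSeparableIn_prolateChart hD hF ha z₀,
          ThreeBody.isSeparableIn_oblateChart hD hF ha z₀⟩⟩⟩
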